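/- Notation. For $g\colon\mathbb R\to[0,\infty]$ let $g^*(t)=\inf\{y\ge 0: |\{g>y\}|<t\}$, $t>0$, be its left-continuous nonincreasing rearrangement. For a measurable function $f$ on $\mathbb R^n$ and $1\le k\le n$ let $\mathcal R_kf$ be obtained by replacing, for each fixed value of the other variables, the function $x_k\mapsto |f(x)|$ by its rearrangement. For a permutation $\sigma=(k_1,\dots,k_n)$ of $\{1,\dots,n\}$ put $\mathcal R_\sigma f=\mathcal R_{k_n}\cdots\mathcal R_{k_1}f$, a function on $\mathbb R^n_+=(0,\infty)^n$. With $\pi(t)=t_1\cdots t_n$ and $0<q<\infty$, put $$\|f\|_{\mathcal L^{q,r}_\sigma}=\Big(\int_{\mathbb R^n_+}\big[\pi(t)^{1/q}\mathcal R_\sigma f(t)\big]^r\frac{dt}{\pi(t)}\Big)^{1/r}\quad(0<r<\infty),\qquad \|f\|_{\mathcal L^{q,\infty}_\sigma}=\operatorname*{ess\,sup}_{t\in\mathbb R^n_+}\pi(t)^{1/q}\mathcal R_\sigma f(t).$$ For $f\in L^p(\mathbb R^n)$ let $\omega_k(f;\delta)_p=\sup_{|h|\le\delta}\|f(\cdot+he_k)-f\|_{L^p(\mathbb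 R^n)}$. For $0<\alpha<1$ let $$\|f\|_{b^\alpha_{p,\theta;k}}=\Big(\int_0^\infty\big(t^{-\alpha}\omega_k(f;t)_p\big)^\theta\frac{dt}{t}\Big)^{1/\theta}\quad(1\le\theta<\infty),\qquad \|f\|_{b^\alpha_{p,\infty;k}}=\sup_{\delta>0}\delta^{-\alpha}\omega_k(f;\delta)_p,$$ and let $B^\alpha_{p,\theta;k}(\mathbb R^n)$ be the set of all $f\in L^p(\mathbb R^n)$ with $\|f\|_{b^\alpha_{p,\theta;k}}<\infty$. Theorem. Let $n\ge2$, $1\le p<\infty$, $p\le\theta_j\le\infty$ and $0<\beta_j<1$ for $j=1,\dots,n$. Set $$\beta=n\Big(\sum_{j=1}^n\frac1{\beta_j}\Big)^{-1},\qquad \theta=\frac n\beta\Big(\sum_{j=1}^n\frac1{\beta_j\theta_j}\Big)^{-1}$$ (with $1/\infty=0$, and $\theta=\infty$ if all $\theta_j=\infty$). Assume that $p<n/\beta$ and let $q=np/(n-\beta p)$. Then there is a constant $c>0$, depending only on $n$ and on an upper bound $Q$ for $q$, such that for every $f\in\bigcap_{j=1}^nB^{\beta_j}_{p,\theta_j;j}(\mathbb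 R^n)$ and every permutation $\sigma$ of $\{1,\dots,n\}$ $$\|f\|_{\mathcal L^{q,\theta}_\sigma}\le c\prod_{j=1}^n\Big[(1-\beta_j)^{1/\theta_j}\|f\|_{b^{\beta_j}_{p,\theta_j;j}}\Big]^{\beta/(n\beta_j)}.$$ -/

import Mathlib

open MeasureTheory
open scoped ENNReal

namespace AnisoBesov

noncomputable section

/-- Distribution function `y ↦ |{x : g x > y}|` of a nonnegative function on the line. -/
def distribution (g : ℝ → ℝ≥0∞) (y : ℝ≥0∞) : ℝ≥0∞ :=
  volume {x : ℝ | y < g x}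

/-- The left-continuous nonincreasing rearrangement `g^*(t) = inf {y ≥ 0 : |{g > y}| < t}`, `t > 0`,
of a nonnegative function on the line. It agrees with `sup_{|E| = t} inf_E g`. -/
def rearrangement (g : ℝ → ℝ≥0∞) (t : ℝ) : ℝ≥0∞ :=
  sInf {y : ℝ≥0∞ | distribution g y < ENNReal.ofReal t}

/-- Rearrangement with respect to the `k`-th variable: the section of `g` along the `k`-th
coordinate is replaced by its rearrangement. The result lives on `{x : 0 < x k}` and is
extended by `0`. -/
def partialRearrangement {n : ℕ} (k : Fin n) (g : (Fin n → ℝ) → ℝ≥0∞) (x : Fin n → ℝ) : ℝ≥0∞ :=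
  if 0 < x k then rearrangement (fun s : ℝ => g (Function.update x k s)) (x k) else 0

/-- The iterated rearrangement `R_σ f = R_{σ(n)} ⋯ R_{σ(1)} |f|` on the open positive orthant:
the variable `σ 0` is rearranged first, and the variable `σ (n - 1)` last. -/
def iteratedRearrangement {n : ℕ} (σ : Equiv.Perm (Fin n)) (f : (Fin n → ℝ) → ℝ) :
    (Fin n → ℝ) → ℝ≥0∞ :=
  (List.ofFn σ).foldl (fun g k => partialRearrangement k g) (fun x => ‖f x‖ₑ)

/-- The open positive orthant `ℝ^n_+`. -/
def posOrthant (n : ℕ) : Set (Fin n → ℝ) := {t | ∀ i, 0 < t i}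

/-- The modified Lorentz norm
`(∫_{ℝ^n_+} (π(t)^{1/q} R_σ f(t))^r dt/π(t))^{1/r}`, `π(t) = t_1 ⋯ t_n`, with the (essential)
supremum of `π(t)^{1/q} R_σ f(t)` for `r = ∞`. -/
def modLorentzNorm {n : ℕ} (q : ℝ) (r : ℝ≥0∞) (σ : Equiv.Perm (Fin n))
    (f : (Fin n → ℝ) → ℝ) : ℝ≥0∞ :=
  if r = ∞ then
    essSup (fun t => ENNReal.ofReal ((∏ i, t i) ^ (1 / q)) * iteratedRearrangement σ f t)
      (volume.restrict (posOrthant n))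
  else
    (∫⁻ t in posOrthant n,
      (ENNReal.ofReal ((∏ i, t i) ^ (1 / q)) * iteratedRearrangement σ f t) ^ r.toReal
        / ENNReal.ofReal (∏ i, t i)) ^ (1 / r.toReal)

/-- The partial modulus of continuity
`ω_k(f; δ)_p = sup_{|h| ≤ δ} ‖f(· + h e_k) - f‖_p`. -/
def partialModulus {n : ℕ} (p : ℝ) (k : Fin n) (f : (Fin n → ℝ) → ℝ) (δ : ℝ) : ℝ≥0∞ :=
  ⨆ (h : ℝ) (_ : |h| ≤ δ),
    eLpNorm (fun x => f (x + Pi.single k h) - f x) (ENNReal.ofReal p) volume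

/-- The partial Besov seminorm `‖f‖_{b^α_{p,θ;k}}`, that is
`(∫_0^∞ (t^{-α} ω_k(f;t)_p)^θ dt/t)^{1/θ}` for `θ < ∞`, and
`sup_{δ>0} ω_k(f;δ)_p / δ^α` for `θ = ∞`. -/
def besovSeminorm {n : ℕ} (α p : ℝ) (θ : ℝ≥0∞) (k : Fin n) (f : (Fin n → ℝ) → ℝ) : ℝ≥0∞ :=
  if θ = ∞ then
    ⨆ (δ : ℝ) (_ : 0 < δ), partialModulus p k f δ / ENNReal.ofReal (δ ^ α)
  else
    (∫⁻ t in Set.Ioi (0 : ℝ),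
      (ENNReal.ofReal (t ^ (-α)) * partialModulus p k f t) ^ θ.toReal
        / ENNReal.ofReal t) ^ (1 / θ.toReal)

/-- Membership in the partial Besov space `B^α_{p,θ;k}(ℝ^n)`. -/
def MemBesov {n : ℕ} (α p : ℝ) (θ : ℝ≥0∞) (k : Fin n) (f : (Fin n → ℝ) → ℝ) : Prop :=
  MemLp f (ENNReal.ofReal p) volume ∧ besovSeminorm α p θ k f < ∞

end

end AnisoBesov

open AnisoBesov

/-! ### Rearrangement on the line: contraction of positive parts of differences. -/

section LineRearrangement

/-! Write F for the iterated rearrangement, λ_j = β/(nβ_j), so that ∑ λ_j = 1, and D_k for the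
decrease of F when the k-th coordinate is doubled. The proof compares F with the D_k on the dyadic
boxes indexed by ν ∈ ℤ^n.

The moduli of f control D_k. On the line, g^*(t) - g^*(2t), weighted by h/t and measured in L^p over
all t ≥ h at once, is bounded by an average of ‖(g - g(· + u))_+‖_p over 0 < u < 4h
(`lintegral_weighted_doubling_gap_le`): a superlevel set of g barely larger than a smaller one must
be left by many short translates. Rearrangement contracts positive parts of differences in L^p
(`lintegral_rearrangement_tsub_rpow_le`), and rearrangement in other variables commutes with maps of
the k-th one. Hence the weighted D_k is bounded by ω_k(f;δ)_p for every δ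
(`lintegral_tailWeight_iteratedRearrangement_le`). Since the weight δ/t keeps all scales above δ,
integrating over δ up to 2^{ν_k} produces 1/(1-β_k), which is the sharp factor
(`lpSumLe_boxNorm_doublingGap`).

On boxes, ‖F‖_ν ≤ ‖D_k‖_ν + 2^{-1/p} ‖F‖_{ν+e_k} for each k. Taking at every ν the k with the
smallest ‖D_k‖_ν replaces this term by the geometric mean ∏ ‖D_j‖_ν^{λ_j}, which combines the
different smoothness orders. The inequality is then iterated along the resulting path. That path is
unknown, so the normalized norms 2^{-β_j ν_j}‖D_j‖_ν are first replaced by majorants varying by at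
most a factor 2^ε per step, at bounded cost in ℓ^{θ_j}. The geometric series converges because 1/p -
β/n = 1/q ≥ 2ε (`le_of_exists_step_le`, `iteratedRearrangement_le_prod_slowMajorant`). Monotonicity
of F turns box norms into pointwise bounds, and Hölder with 1/θ = ∑ λ_j/θ_j sums them
(`tsum_prod_rpow_le`). -/

lemma distribution_antitone (g : ℝ → ℝ≥0∞) : Antitone (distribution g) := fun _ _ h =>
  measure_mono fun _ hx => lt_of_le_of_lt h hx

lemma rearrangement_antitone (g : ℝ → ℝ≥0∞) : Antitone (rearrangement g) := fun _ _ h =>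
  sInf_le_sInf fun _ hy => lt_of_lt_of_le hy (ENNReal.ofReal_le_ofReal h)

lemma rearrangement_mono {g h : ℝ → ℝ≥0∞} (hgh : g ≤ h) (t : ℝ) :
    rearrangement g t ≤ rearrangement h t :=
  sInf_le_sInf fun _ hy => lt_of_le_of_lt (measure_mono fun x hx => lt_of_lt_of_le hx (hgh x)) hy

lemma rearrangement_congr_ae {g h : ℝ → ℝ≥0∞} (hgh : g =ᵐ[volume] h) :
    rearrangement g = rearrangement h := by
  have : distribution g = distribution h := by
    funext y
    refine measure_congr ?_
    filter_upwards [hgh] with x hx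
    change (y < g x) = (y < h x)
    rw [hx]
  funext t
  simp [rearrangement, this]

lemma rearrangement_zero {t : ℝ} (ht : 0 < t) : rearrangement (fun _ => 0) t = 0 := by
  refine le_antisymm (sInf_le ?_) bot_le
  simp [distribution, ht]

lemma le_distribution_of_lt_rearrangement {g : ℝ → ℝ≥0∞} {t : ℝ} {y : ℝ≥0∞}
    (h : y < rearrangement g t) : ENNReal.ofReal t ≤ distribution g y := by
  by_contra! hc
  exact absurd (sInf_le (a := y) hc) (not_le.2 h)

/-- This is right continuity of the distribution function: some level strictly above y still has a
superlevel set of measure greater than t. -/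
lemma lt_rearrangement_of_lt_distribution {g : ℝ → ℝ≥0∞} {t : ℝ} {y : ℝ≥0∞}
    (h : ENNReal.ofReal t < distribution g y) : y < rearrangement g t := by
  have hy : y ≠ ∞ := by
    rintro rfl
    simp [distribution] at h
  obtain ⟨u, hu, huy, hlim⟩ := exists_seq_strictAnti_tendsto' (lt_top_iff_ne_top.2 hy)
  have hU : {x | y < g x} = ⋃ i, {x | u i < g x} := by
    ext x
    simp only [Set.mem_ofPred_eq, Set.mem_iUnion]
    constructor
    · intro hx
      exact (hlim.eventually (gt_mem_nhds hx)).exists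
    · rintro ⟨i, hi⟩
      exact (huy i).1.trans hi
  have hmono : Monotone fun i => {x | u i < g x} := fun i j hij x hx =>
    lt_of_le_of_lt (hu.antitone hij) hx
  rw [distribution, hU, hmono.measure_iUnion] at h
  obtain ⟨i, hi⟩ := lt_iSup_iff.1 h
  refine lt_of_lt_of_le (huy i).1 (le_sInf fun z hz => ?_)
  by_contra! hc
  exact absurd (hi.trans_le (distribution_antitone g hc.le)) (not_lt.2 (le_of_lt hz))

lemma distribution_rearrangement_le (g : ℝ → ℝ≥0∞) (t : ℝ) :
    distribution g (rearrangement g t) ≤ ENNReal.ofReal t := by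
  by_contra! hc
  exact lt_irrefl _ (lt_rearrangement_of_lt_distribution hc)

/-- The closed superlevel set is the decreasing intersection of open ones at levels increasing to
g^*(t). Continuity from above needs one of them to have finite measure, hence `hfin`. -/
lemma le_volume_superlevel_rearrangement {g : ℝ → ℝ≥0∞} (hg : Measurable g) {t : ℝ} {y : ℝ≥0∞}
    (hy : y < rearrangement g t) (hfin : distribution g y ≠ ∞) :
    ENNReal.ofReal t ≤ volume {x | rearrangement g t ≤ g x} := by
  obtain ⟨u, hu, huy, hlim⟩ := exists_seq_strictMono_tendsto' hy
  have hI : {x | rearrangement g t ≤ g x} = ⋂ i, {x | u i < g x} := by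
    ext x
    simp only [Set.mem_ofPred_eq, Set.mem_iInter]
    constructor
    · intro hx i
      exact (huy i).2.trans_le hx
    · intro h
      exact le_of_tendsto' hlim fun i => (h i).le
  have hanti : Antitone fun i => {x | u i < g x} := fun i j hij x hx =>
    lt_of_le_of_lt (hu.monotone hij) hx
  rw [hI, hanti.measure_iInter (fun i => (measurableSet_lt measurable_const hg).nullMeasurableSet)
    ⟨0, ne_top_of_le_ne_top hfin (distribution_antitone g (huy 0).1.le)⟩]
  exact le_iInf fun i => le_distribution_of_lt_rearrangement (huy i).2

lemma rearrangement_add_const_le (h : ℝ → ℝ≥0∞) (s : ℝ≥0∞) (t : ℝ) :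
    rearrangement (fun x => h x + s) t ≤ rearrangement h t + s := by
  rw [rearrangement, rearrangement, ENNReal.sInf_add]
  refine le_iInf₂ fun y hy => sInf_le ?_
  refine lt_of_le_of_lt (measure_mono fun x hx => ?_) hy
  have hx' : y + s < h x + s := hx
  exact lt_of_add_lt_add_right hx'

lemma tsub_eq_lintegral_indicator (a b : ℝ≥0∞) :
    a - b = ∫⁻ y in Set.Ioi (0 : ℝ),
      {y : ℝ | b ≤ ENNReal.ofReal y ∧ ENNReal.ofReal y < a}.indicator 1 y := by
  have hm : MeasurableSet {y : ℝ | b ≤ ENNReal.ofReal y ∧ ENNReal.ofReal y < a} :=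
    (measurableSet_le measurable_const ENNReal.measurable_ofReal).inter
      (measurableSet_lt ENNReal.measurable_ofReal measurable_const)
  rw [lintegral_indicator_one hm, Measure.restrict_apply hm]
  rcases eq_or_ne b ∞ with rfl | hb
  · have : {y : ℝ | ∞ ≤ ENNReal.ofReal y ∧ ENNReal.ofReal y < a} = ∅ := by
      ext y; simp
    rw [this]; simp
  lift b to NNReal using hb
  rcases eq_or_ne a ∞ with rfl | ha
  · symm
    rw [ENNReal.top_sub_coe, ← top_le_iff, ]
    refine (Real.volume_Ioi (a := (b : ℝ))).symm.le.trans (measure_mono fun y hy => ?_)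
    have hy' : (b : ℝ) < y := hy
    refine ⟨⟨?_, ENNReal.ofReal_lt_top⟩, lt_of_le_of_lt b.coe_nonneg hy'⟩
    rw [ENNReal.coe_nnreal_eq]
    exact ENNReal.ofReal_le_ofReal hy'.le
  lift a to NNReal using ha
  have hset : {y : ℝ | (b : ℝ≥0∞) ≤ ENNReal.ofReal y ∧ ENNReal.ofReal y < a} ∩ Set.Ioi 0 =
      Set.Ico (b : ℝ) a ∩ Set.Ioi 0 := by
    ext y
    simp only [Set.mem_inter_iff, Set.mem_ofPred_eq, Set.mem_Ioi, Set.mem_Ico]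
    refine and_congr_left fun hy => ?_
    rw [ENNReal.coe_nnreal_eq, ENNReal.coe_nnreal_eq, ENNReal.ofReal_le_ofReal_iff hy.le,
      ENNReal.ofReal_lt_ofReal_iff_of_nonneg hy.le]
  have hae : (Set.Ico (b : ℝ) a ∩ Set.Ioi 0 : Set ℝ) =ᵐ[volume] Set.Ioo (b : ℝ) a := by
    have h1 : (Set.Ico (b : ℝ) a : Set ℝ) =ᵐ[volume] Set.Ioo (b : ℝ) a := Ioo_ae_eq_Ico.symm
    have h2 := h1.inter (ae_eq_refl (Set.Ioi (0 : ℝ)))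
    refine h2.trans (Filter.EventuallyEq.of_eq ?_)
    exact Set.inter_eq_left.2 fun y hy => lt_of_le_of_lt b.coe_nonneg hy.1
  rw [hset, measure_congr hae, Real.volume_Ioo, ENNReal.ofReal_sub _ b.coe_nonneg]
  simp

lemma volume_Icc_ennreal_le (a b : ℝ≥0∞) :
    volume {t : ℝ | 0 < t ∧ b ≤ ENNReal.ofReal t ∧ ENNReal.ofReal t ≤ a} ≤ a - b := by
  rcases eq_or_ne b ∞ with rfl | hb
  · have : {t : ℝ | 0 < t ∧ ∞ ≤ ENNReal.ofReal t ∧ ENNReal.ofReal t ≤ a} = ∅ := by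
      ext y; simp
    rw [this]; simp
  rcases eq_or_ne a ∞ with rfl | ha
  · simp [ENNReal.top_sub hb]
  lift b to NNReal using hb
  lift a to NNReal using ha
  have : {t : ℝ | 0 < t ∧ (b : ℝ≥0∞) ≤ ENNReal.ofReal t ∧ ENNReal.ofReal t ≤ a} ⊆
      Set.Icc (b : ℝ) a := by
    rintro t ⟨h0, h1, h2⟩
    rw [ENNReal.coe_nnreal_eq, ENNReal.ofReal_le_ofReal_iff h0.le] at h1
    rw [ENNReal.coe_nnreal_eq, ENNReal.ofReal_le_ofReal_iff a.coe_nonneg] at h2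
    exact ⟨h1, h2⟩
  refine (measure_mono this).trans ?_
  rw [Real.volume_Icc, ENNReal.ofReal_sub _ b.coe_nonneg]
  simp

lemma measurable_rearrangement (g : ℝ → ℝ≥0∞) : Measurable (rearrangement g) :=
  (rearrangement_antitone g).measurable

lemma lintegral_tsub_eq {α : Type*} [MeasurableSpace α] {μ : Measure α} [SFinite μ]
    {g h : α → ℝ≥0∞} (hg : Measurable g) (hh : Measurable h) :
    ∫⁻ x, (g x - h x) ∂μ =
      ∫⁻ y in Set.Ioi (0 : ℝ), μ {x | h x ≤ ENNReal.ofReal y ∧ ENNReal.ofReal y < g x} := by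
  have hS : MeasurableSet {z : α × ℝ | h z.1 ≤ ENNReal.ofReal z.2 ∧ ENNReal.ofReal z.2 < g z.1} :=
    (measurableSet_le (hh.comp measurable_fst) (ENNReal.measurable_ofReal.comp measurable_snd)).inter
      (measurableSet_lt (ENNReal.measurable_ofReal.comp measurable_snd) (hg.comp measurable_fst))
  simp_rw [tsub_eq_lintegral_indicator]
  rw [lintegral_lintegral_swap]
  · refine lintegral_congr fun y => ?_
    have hy : MeasurableSet {x | h x ≤ ENNReal.ofReal y ∧ ENNReal.ofReal y < g x} :=
      (measurableSet_le hh measurable_const).inter (measurableSet_lt measurable_const hg)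
    rw [← lintegral_indicator_one hy]
    exact lintegral_congr fun x => rfl
  · exact ((measurable_const (a := (1 : ℝ≥0∞))).indicator hS).aemeasurable

/-- By the layer-cake formula it suffices to compare, for each level y, the sets where y lies
between the two functions. For the rearrangements this set lies between the distribution functions
of h and g at y, and the difference of these is at most |{g > y} \ {h > y}|. -/
lemma lintegral_rearrangement_tsub_le {g h : ℝ → ℝ≥0∞} (hg : Measurable g) (hh : Measurable h) :
    ∫⁻ t in Set.Ioi (0 : ℝ), (rearrangement g t - rearrangement h t) ≤ ∫⁻ x, (g x - h x) := by
  rw [lintegral_tsub_eq (measurable_rearrangement g) (measurable_rearrangement h),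
    lintegral_tsub_eq hg hh]
  refine lintegral_mono fun y => ?_
  rw [Measure.restrict_apply' measurableSet_Ioi]
  calc _ ≤ volume {t : ℝ | 0 < t ∧ distribution h (ENNReal.ofReal y) ≤ ENNReal.ofReal t ∧
          ENNReal.ofReal t ≤ distribution g (ENNReal.ofReal y)} := by
        refine measure_mono ?_
        rintro t ⟨⟨h1, h2⟩, h0⟩
        exact ⟨h0, (distribution_antitone h h1).trans (distribution_rearrangement_le h t),
          le_distribution_of_lt_rearrangement h2⟩
    _ ≤ distribution g (ENNReal.ofReal y) - distribution h (ENNReal.ofReal y) :=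
        volume_Icc_ennreal_le _ _
    _ ≤ volume ({x | ENNReal.ofReal y < g x} \ {x | ENNReal.ofReal y < h x}) :=
        le_measure_sdiff
    _ ≤ _ := measure_mono fun x hx => by
        exact ⟨not_lt.1 hx.2, hx.1⟩

lemma lintegral_power_kernel {p : ℝ} (hp : 1 < p) {x : ℝ} (hx : 0 < x) :
    ∫⁻ s in Set.Ioi (0 : ℝ), ENNReal.ofReal (p * (p - 1) * s ^ (p - 2)) *
      (ENNReal.ofReal x - ENNReal.ofReal s) = ENNReal.ofReal (x ^ p) := by
  have hderiv : ∀ s ∈ Set.Ioo (0 : ℝ) x,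
      HasDerivAt (fun s => p * x * s ^ (p - 1) - (p - 1) * s ^ p)
        (p * (p - 1) * s ^ (p - 2) * (x - s)) s := by
    intro s hs
    have h1 := (Real.hasDerivAt_rpow_const (x := s) (p := p - 1) (Or.inl hs.1.ne')).const_mul (p * x)
    have h2 := (Real.hasDerivAt_rpow_const (x := s) (p := p) (Or.inl hs.1.ne')).const_mul (p - 1)
    refine (h1.sub h2).congr_deriv ?_
    have h3 : s ^ (p - 1) = s ^ (p - 2) * s := by
      rw [← Real.rpow_add_one hs.1.ne']; ring_nf
    have h4 : p - 1 - 1 = p - 2 := by ring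
    rw [h3, h4]; ring
  have hcont : ContinuousOn (fun s => p * x * s ^ (p - 1) - (p - 1) * s ^ p) (Set.Icc 0 x) := by
    refine ContinuousOn.sub (continuousOn_const.mul ?_) (continuousOn_const.mul ?_)
    · exact continuousOn_id.rpow_const fun _ _ => Or.inr (by linarith)
    · exact continuousOn_id.rpow_const fun _ _ => Or.inr (by linarith)
  have hnonneg : ∀ s ∈ Set.Ioo (0 : ℝ) x, 0 ≤ p * (p - 1) * s ^ (p - 2) * (x - s) := fun s hs =>
    mul_nonneg (mul_nonneg (mul_nonneg (by linarith) (by linarith)) (Real.rpow_nonneg hs.1.le _))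
      (by linarith [hs.2])
  have hint := intervalIntegral.integrableOn_deriv_of_nonneg hcont hderiv hnonneg
  have hval := intervalIntegral.integral_eq_sub_of_hasDerivAt_of_le hx.le hcont hderiv
    ((intervalIntegrable_iff_integrableOn_Ioc_of_le hx.le).2 hint)
  have hF : p * x * x ^ (p - 1) - (p - 1) * x ^ p - (p * x * 0 ^ (p - 1) - (p - 1) * 0 ^ p)
      = x ^ p := by
    rw [Real.zero_rpow (by linarith), Real.zero_rpow (by linarith)]
    have : x ^ p = x ^ (p - 1) * x := by rw [← Real.rpow_add_one hx.ne']; ring_nf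
    rw [this]; ring
  rw [hF, intervalIntegral.integral_of_le hx.le] at hval
  rw [← hval, ofReal_integral_eq_lintegral_ofReal hint]
  · rw [← Set.Ioc_union_Ioi_eq_Ioi hx.le, lintegral_union measurableSet_Ioi
      (Set.Ioc_disjoint_Ioi le_rfl)]
    have h0 : ∫⁻ s in Set.Ioi x, ENNReal.ofReal (p * (p - 1) * s ^ (p - 2)) *
        (ENNReal.ofReal x - ENNReal.ofReal s) = 0 := by
      rw [setLIntegral_congr_fun (g := fun _ => 0) measurableSet_Ioi, lintegral_zero]
      intro s hs
      beta_reduce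
      rw [tsub_eq_zero_of_le (ENNReal.ofReal_le_ofReal (le_of_lt hs)), mul_zero]
    rw [h0, add_zero]
    refine setLIntegral_congr_fun measurableSet_Ioc fun s hs => ?_
    rw [← ENNReal.ofReal_sub _ hs.1.le, ← ENNReal.ofReal_mul]
    exact mul_nonneg (mul_nonneg (by linarith) (by linarith)) (Real.rpow_nonneg hs.1.le _)
  · refine (ae_restrict_iff' measurableSet_Ioc).2 (Filter.Eventually.of_forall fun s hs => ?_)
    rcases eq_or_lt_of_le hs.2 with h | h
    · simp [h]
    · exact hnonneg s ⟨hs.1, h⟩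

lemma rpow_eq_lintegral_tsub {p : ℝ} (hp : 1 < p) (x : ℝ≥0∞) :
    x ^ p = ∫⁻ s in Set.Ioi (0 : ℝ), ENNReal.ofReal (p * (p - 1) * s ^ (p - 2)) *
      (x - ENNReal.ofReal s) := by
  have hp0 : 0 < p := by linarith
  have hfin : ∀ y : ℝ, 0 < y → ENNReal.ofReal y ^ p =
      ∫⁻ s in Set.Ioi (0 : ℝ), ENNReal.ofReal (p * (p - 1) * s ^ (p - 2)) *
      (ENNReal.ofReal y - ENNReal.ofReal s) := fun y hy => by
    rw [lintegral_power_kernel hp hy, ENNReal.ofReal_rpow_of_pos hy]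
  rcases eq_or_ne x ∞ with rfl | hx
  · rw [ENNReal.top_rpow_of_pos hp0, eq_comm]
    refine ENNReal.eq_top_of_forall_nnreal_le fun r => ?_
    have hr : (0 : ℝ) < r + 1 := by positivity
    calc (r : ℝ≥0∞) ≤ ENNReal.ofReal (r + 1) := by
          rw [ENNReal.coe_nnreal_eq]; exact ENNReal.ofReal_le_ofReal (by linarith)
      _ ≤ ENNReal.ofReal (r + 1) ^ p := by
          refine ENNReal.le_rpow_self_of_one_le ?_ hp.le
          rw [← ENNReal.ofReal_one]
          exact ENNReal.ofReal_le_ofReal (by linarith [r.2])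
      _ = _ := hfin _ hr
      _ ≤ _ := lintegral_mono fun s => by gcongr; exact le_top
  · rcases eq_or_ne x 0 with rfl | h0
    · simp [hp0]
    · have := hfin x.toReal (ENNReal.toReal_pos h0 hx)
      rwa [ENNReal.ofReal_toReal hx] at this

/-- The power x^p is a positive superposition of the truncations (x - s)_+, and (g - h)_+ truncated
at s is the positive part of g - (h + s). This reduces exponent p to exponent 1. -/
lemma lintegral_tsub_rpow_eq {α : Type*} [MeasurableSpace α] {μ : Measure α} [SFinite μ]
    {g h : α → ℝ≥0∞} (hg : Measurable g) (hh : Measurable h) {p : ℝ} (hp : 1 < p) :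
    ∫⁻ x, (g x - h x) ^ p ∂μ = ∫⁻ s in Set.Ioi (0 : ℝ),
      ENNReal.ofReal (p * (p - 1) * s ^ (p - 2)) * ∫⁻ x, (g x - (h x + ENNReal.ofReal s)) ∂μ := by
  simp_rw [rpow_eq_lintegral_tsub hp]
  rw [lintegral_lintegral_swap]
  · refine lintegral_congr fun s => ?_
    rw [lintegral_const_mul _ (by fun_prop)]
    simp_rw [tsub_tsub]
  · refine Measurable.aemeasurable ?_
    fun_prop

/-- Rearrangement does not increase the `p`-th moment of the positive part of a difference. -/
theorem lintegral_rearrangement_tsub_rpow_le {g h : ℝ → ℝ≥0∞} (hg : Measurable g)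
    (hh : Measurable h) {p : ℝ} (hp : 1 ≤ p) :
    ∫⁻ t in Set.Ioi (0 : ℝ), (rearrangement g t - rearrangement h t) ^ p ≤
      ∫⁻ x, (g x - h x) ^ p := by
  rcases eq_or_lt_of_le hp with rfl | hp
  · simpa using lintegral_rearrangement_tsub_le hg hh
  rw [lintegral_tsub_rpow_eq (measurable_rearrangement g) (measurable_rearrangement h) hp,
    lintegral_tsub_rpow_eq hg hh hp]
  refine lintegral_mono fun s => ?_
  refine mul_le_mul' le_rfl (le_trans (lintegral_mono fun t => ?_)
    (lintegral_rearrangement_tsub_le hg (h := fun x => h x + ENNReal.ofReal s) (by fun_prop)))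
  exact tsub_le_tsub_left (rearrangement_add_const_le h _ t) _

end LineRearrangement

/-! ### Doubling gaps of the rearrangement versus translates. -/

section Translates

/-- The function s ↦ |A ∩ (s, ∞)| is 1-Lipschitz with limits 0 and |A|, so the intermediate value
theorem applies. -/
lemma exists_volume_inter_Ioi_eq {A : Set ℝ} (hA : MeasurableSet A) (hfin : volume A ≠ ∞) {c : ℝ}
    (hc : 0 < c) (hcA : ENNReal.ofReal c < volume A) :
    ∃ s, volume (A ∩ Set.Ioi s) = ENNReal.ofReal c := by
  have hne : ∀ s, volume (A ∩ Set.Ioi s) ≠ ∞ := fun s =>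
    ne_top_of_le_ne_top hfin (measure_mono Set.inter_subset_left)
  set φ : ℝ → ℝ := fun s => (volume (A ∩ Set.Ioi s)).toReal with hφ
  have hlip : LipschitzWith 1 φ := by
    refine LipschitzWith.of_le_add fun s t => ?_
    have h1 : volume (A ∩ Set.Ioi s) ≤ volume (A ∩ Set.Ioi t) + ENNReal.ofReal (dist s t) := by
      calc volume (A ∩ Set.Ioi s) ≤ volume ((A ∩ Set.Ioi t) ∪ Set.Ioc s t) := by
            refine measure_mono fun x hx => ?_
            rcases lt_or_ge t x with h | h
            · exact Or.inl ⟨hx.1, h⟩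
            · exact Or.inr ⟨hx.2, h⟩
        _ ≤ volume (A ∩ Set.Ioi t) + volume (Set.Ioc s t) := measure_union_le _ _
        _ ≤ _ := by
            rw [Real.volume_Ioc]
            gcongr
            rw [Real.dist_eq, abs_sub_comm]
            exact le_abs_self _
    have h2 := ENNReal.toReal_mono (ENNReal.add_ne_top.2 ⟨hne t, ENNReal.ofReal_ne_top⟩) h1
    rwa [ENNReal.toReal_add (hne t) ENNReal.ofReal_ne_top, ENNReal.toReal_ofReal dist_nonneg] at h2
  have hlow : ∃ s, φ s ≤ c := by
    have hanti : Antitone fun i : ℕ => A ∩ Set.Ioi (i : ℝ) := fun i j hij =>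
      Set.inter_subset_inter_right _ (Set.Ioi_subset_Ioi (by exact_mod_cast hij))
    have h0 := hanti.measure_iInter (μ := volume)
      (fun i => (hA.inter measurableSet_Ioi).nullMeasurableSet) ⟨0, hne _⟩
    have hemp : ⋂ i : ℕ, A ∩ Set.Ioi (i : ℝ) = ∅ := by
      ext x
      simp only [Set.mem_iInter, Set.mem_inter_iff, Set.mem_Ioi, Set.mem_empty_iff_false, iff_false]
      intro h
      obtain ⟨m, hm⟩ := exists_nat_gt x
      exact absurd (h m).2 hm.le.not_gt
    rw [hemp, measure_empty] at h0
    have : ⨅ i : ℕ, volume (A ∩ Set.Ioi (i : ℝ)) < ENNReal.ofReal c := by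
      rw [← h0]; exact ENNReal.ofReal_pos.2 hc
    obtain ⟨i, hi⟩ := iInf_lt_iff.1 this
    exact ⟨i, ENNReal.toReal_le_of_le_ofReal hc.le hi.le⟩
  have hhigh : ∃ s, c ≤ φ s := by
    have hmono : Monotone fun i : ℕ => A ∩ Set.Ioi (-(i : ℝ)) := fun i j hij =>
      Set.inter_subset_inter_right _ (Set.Ioi_subset_Ioi (by
        have : (i : ℝ) ≤ j := by exact_mod_cast hij
        linarith))
    have hU : ⋃ i : ℕ, A ∩ Set.Ioi (-(i : ℝ)) = A := by
      ext x
      simp only [Set.mem_iUnion, Set.mem_inter_iff, Set.mem_Ioi, exists_and_left,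
        and_iff_left_iff_imp]
      intro _
      obtain ⟨m, hm⟩ := exists_nat_gt (-x)
      exact ⟨m, by linarith⟩
    rw [← hU, hmono.measure_iUnion] at hcA
    obtain ⟨i, hi⟩ := lt_iSup_iff.1 hcA
    exact ⟨_, (ENNReal.ofReal_le_iff_le_toReal (hne _)).1 hi.le⟩
  obtain ⟨s, hs⟩ := mem_range_of_exists_le_of_exists_ge hlip.continuous hlow hhigh
  exact ⟨s, by rw [← hs, hφ, ENNReal.ofReal_toReal (hne s)]⟩

/-- If `A ⊆ B`, `|A| ≥ h` and `|B \ A| ≤ h`, then at least `h²` pairs `(x, u)` with `0 < u < 4h`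
satisfy `x ∈ A` and `x + u ∉ B`. -/
lemma sq_le_lintegral_exit_pairs {A B : Set ℝ} (hA : MeasurableSet A) (hB : MeasurableSet B)
    (hAB : A ⊆ B) (hBfin : volume B ≠ ∞) {h : ℝ} (hh : 0 < h) (hAh : ENNReal.ofReal h ≤ volume A)
    (hBA : volume B ≤ volume A + ENNReal.ofReal h) :
    ENNReal.ofReal (h ^ 2) ≤ ∫⁻ u in Set.Ioo 0 (4 * h), ∫⁻ x,
      {x | x ∈ A ∧ x + u ∉ B}.indicator 1 x := by
  have hAfin : volume A ≠ ∞ := ne_top_of_le_ne_top hBfin (measure_mono hAB)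
  -- Take the rightmost piece of A, of measure h/2. To the right of s the set B has measure at most
  -- 2h, so for each x in this piece at least 2h of the 4h shifts land outside B, and 2h · h/2 = h².
  obtain ⟨s, hs⟩ := exists_volume_inter_Ioi_eq hA hAfin (c := h / 2) (by linarith)
    (lt_of_lt_of_le ((ENNReal.ofReal_lt_ofReal_iff hh).2 (by linarith)) hAh)
  have hdiff : volume (B \ A) ≤ ENNReal.ofReal h := by
    rw [measure_sdiff hAB hA.nullMeasurableSet hAfin]
    exact tsub_le_iff_left.2 hBA
  have hBs : volume (B ∩ Set.Ioi s) ≤ ENNReal.ofReal (2 * h) := by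
    calc volume (B ∩ Set.Ioi s) ≤ volume ((A ∩ Set.Ioi s) ∪ (B \ A)) := by
          refine measure_mono fun x hx => ?_
          by_cases hxA : x ∈ A
          · exact Or.inl ⟨hxA, hx.2⟩
          · exact Or.inr ⟨hx.1, hxA⟩
      _ ≤ ENNReal.ofReal (h / 2) + ENNReal.ofReal h := (measure_union_le _ _).trans (by
          rw [hs]; gcongr)
      _ ≤ _ := by
          rw [← ENNReal.ofReal_add (by linarith) hh.le]
          exact ENNReal.ofReal_le_ofReal (by linarith)
  have hS : MeasurableSet {z : ℝ × ℝ | z.2 ∈ A ∧ z.2 + z.1 ∉ B} := by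
    refine (measurable_snd hA).inter ?_
    have : Measurable fun z : ℝ × ℝ => z.2 + z.1 := by fun_prop
    exact (this hB).compl
  have hSx : ∀ x, MeasurableSet {u | x ∈ A ∧ x + u ∉ B} := fun x =>
    measurable_prodMk_right hS
  rw [lintegral_lintegral_swap (by
    exact ((measurable_const (a := (1 : ℝ≥0∞))).indicator hS).aemeasurable)]
  change _ ≤ ∫⁻ x, ∫⁻ u in Set.Ioo 0 (4 * h), {u | x ∈ A ∧ x + u ∉ B}.indicator 1 u
  have hfib : ∀ x ∈ A ∩ Set.Ioi s, ENNReal.ofReal (2 * h) ≤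
      ∫⁻ u in Set.Ioo 0 (4 * h), {u | x ∈ A ∧ x + u ∉ B}.indicator 1 u := by
    intro x hx
    rw [lintegral_indicator_one (hSx x), Measure.restrict_apply (hSx x)]
    have hsub : volume (Set.Ioo 0 (4 * h) \ ((fun u => x + u) ⁻¹' (B ∩ Set.Ioi s))) ≤
        volume ({u | x ∈ A ∧ x + u ∉ B} ∩ Set.Ioo 0 (4 * h)) := by
      refine measure_mono fun u hu => ⟨⟨hx.1, fun hc => hu.2 ⟨hc, ?_⟩⟩, hu.1⟩
      have h1 : s < x := hx.2
      have h2 : 0 < u := hu.1.1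
      exact lt_trans h1 (by linarith)
    refine le_trans ?_ hsub
    refine le_trans ?_ le_measure_sdiff
    rw [measure_preimage_add, Real.volume_Ioo]
    calc ENNReal.ofReal (2 * h) = ENNReal.ofReal (4 * h - 0) - ENNReal.ofReal (2 * h) := by
          rw [← ENNReal.ofReal_sub _ (by linarith)]; ring_nf
      _ ≤ _ := tsub_le_tsub_left hBs _
  calc ENNReal.ofReal (h ^ 2) = ENNReal.ofReal (2 * h) * volume (A ∩ Set.Ioi s) := by
        rw [hs, ← ENNReal.ofReal_mul (by linarith)]; ring_nf
    _ = ∫⁻ _ in A ∩ Set.Ioi s, ENNReal.ofReal (2 * h) := by rw [setLIntegral_const]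
    _ ≤ ∫⁻ x in A ∩ Set.Ioi s,
        ∫⁻ u in Set.Ioo 0 (4 * h), {u | x ∈ A ∧ x + u ∉ B}.indicator 1 u :=
        setLIntegral_mono' (hA.inter measurableSet_Ioi) hfib
    _ ≤ _ := setLIntegral_le_lintegral _ _

lemma sum_range_tsub_succ_eq {c : ℕ → ℝ≥0∞} (hc : Antitone c) (N : ℕ) :
    ∑ i ∈ Finset.range N, (c i - c (i + 1)) = c 0 - c N := by
  induction N with
  | zero => simp
  | succ N ih =>
    rw [Finset.sum_range_succ, ih, tsub_add_tsub_cancel (hc (Nat.zero_le _)) (hc (Nat.le_succ _))]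

lemma finset_sum_rpow_le_rpow_sum {ι : Type*} (s : Finset ι) (f : ι → ℝ≥0∞) {p : ℝ} (hp : 1 ≤ p) :
    ∑ i ∈ s, f i ^ p ≤ (∑ i ∈ s, f i) ^ p := by
  classical
  induction s using Finset.induction_on with
  | empty => simp
  | insert a s ha ih =>
    rw [Finset.sum_insert ha, Finset.sum_insert ha]
    exact (add_le_add le_rfl ih).trans (ENNReal.add_rpow_le_rpow_add _ _ hp)

lemma tsum_rpow_le_rpow_tsum {ι : Type*} (f : ι → ℝ≥0∞) {p : ℝ} (hp : 1 ≤ p) :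
    ∑' i, f i ^ p ≤ (∑' i, f i) ^ p :=
  ENNReal.summable.tsum_le_of_sum_le fun s =>
    (finset_sum_rpow_le_rpow_sum s f hp).trans
      (ENNReal.rpow_le_rpow (ENNReal.sum_le_tsum s) (by linarith))

/-- The intervals [a_{i+1}, a_i] contained in [H, G] do not overlap, so their lengths add up to at
most G - H; superadditivity of x^p for p ≥ 1 does the rest. Clamping the levels to [H, G] makes the
sum telescope. -/
lemma tsum_level_gaps_rpow_le {a : ℕ → ℝ≥0∞} (ha : Antitone a) (G H : ℝ≥0∞) {p : ℝ}
    (hp : 1 ≤ p) :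
    ∑' i, (if a i ≤ G ∧ H ≤ a (i + 1) then (a i - a (i + 1)) ^ p else 0) ≤ (G - H) ^ p := by
  have hp0 : 0 < p := by linarith
  have h1 : ∀ i, (if a i ≤ G ∧ H ≤ a (i + 1) then (a i - a (i + 1)) ^ p else 0) =
      (if a i ≤ G ∧ H ≤ a (i + 1) then (a i - a (i + 1)) else 0) ^ p := by
    intro i
    split_ifs
    · rfl
    · rw [ENNReal.zero_rpow_of_pos hp0]
  simp_rw [h1]
  refine (tsum_rpow_le_rpow_tsum _ hp).trans (ENNReal.rpow_le_rpow ?_ hp0.le)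
  rcases le_or_gt H G with hHG | hHG
  · refine ENNReal.tsum_le_of_sum_range_le fun N => ?_
    set c : ℕ → ℝ≥0∞ := fun i => max H (min (a i) G) with hcdef
    have hc : Antitone c := fun i j hij =>
      max_le_max le_rfl (min_le_min (ha hij) le_rfl)
    calc _ ≤ ∑ i ∈ Finset.range N, (c i - c (i + 1)) := by
          refine Finset.sum_le_sum fun i _ => ?_
          split_ifs with h
          · have hle : a (i + 1) ≤ a i := ha (Nat.le_succ i)
            have e1 : c i = a i := by
              simp only [hcdef]
              rw [min_eq_left h.1, max_eq_right (h.2.trans hle)]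
            have e2 : c (i + 1) = a (i + 1) := by
              simp only [hcdef]
              rw [min_eq_left (hle.trans h.1), max_eq_right h.2]
            rw [e1, e2]
          · exact bot_le
      _ = c 0 - c N := sum_range_tsub_succ_eq hc N
      _ ≤ G - H := tsub_le_tsub (max_le hHG (min_le_right _ _)) (le_max_left _ _)
  · have : ∀ i, (if a i ≤ G ∧ H ≤ a (i + 1) then (a i - a (i + 1)) else 0) = 0 := by
      intro i
      rw [if_neg]
      rintro ⟨h1, h2⟩
      exact absurd (h2.trans ((ha (Nat.le_succ i)).trans h1)) hHG.not_ge
    simp [this]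

/-- For consecutive levels a_i > a_{i+1}, the sets {g ≥ a_i} and {g > a_{i+1}} have measures at
least (i+1)h and at most (i+2)h, so at least h² pairs (x, u) drop across the whole gap. A given pair
is charged only for disjoint gaps between g(x + u) and g(x), so the sum over i costs nothing. -/
lemma sq_mul_tsum_rearrangement_gaps_le {g : ℝ → ℝ≥0∞} (hg : Measurable g) {h : ℝ} (hh : 0 < h)
    {p : ℝ} (hp : 1 ≤ p) :
    ENNReal.ofReal (h ^ 2) * ∑' i : ℕ,
        (rearrangement g ((i + 1) * h) - rearrangement g ((i + 2) * h)) ^ p ≤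
      ∫⁻ u in Set.Ioo 0 (4 * h), ∫⁻ x, (g x - g (x + u)) ^ p := by
  have hp0 : 0 < p := by linarith
  set a : ℕ → ℝ≥0∞ := fun i => rearrangement g ((i + 1) * h) with hadef
  have ha : Antitone a := fun i j hij => rearrangement_antitone g (by
    have : (i : ℝ) ≤ j := by exact_mod_cast hij
    gcongr)
  have hsucc : ∀ i : ℕ, rearrangement g ((i + 2) * h) = a (i + 1) := fun i => by
    simp only [hadef]; push_cast; ring_nf
  simp_rw [hsucc]
  have hterm : ∀ i : ℕ, ENNReal.ofReal (h ^ 2) * (a i - a (i + 1)) ^ p ≤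
      ∫⁻ u in Set.Ioo 0 (4 * h), ∫⁻ x,
        (if a i ≤ g x ∧ g (x + u) ≤ a (i + 1) then (a i - a (i + 1)) ^ p else 0) := by
    intro i
    rcases le_or_gt (a i) (a (i + 1)) with hle | hlt
    · simp [tsub_eq_zero_of_le hle, ENNReal.zero_rpow_of_pos hp0]
    have hBle : volume {x | a (i + 1) < g x} ≤ ENNReal.ofReal ((i + 2) * h) := by
      have := distribution_rearrangement_le g ((i + 2) * h)
      rwa [hsucc] at this
    have hBfin : volume {x | a (i + 1) < g x} ≠ ∞ := ne_top_of_le_ne_top ENNReal.ofReal_ne_top hBle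
    have hAge : ENNReal.ofReal ((i + 1) * h) ≤ volume {x | a i ≤ g x} :=
      le_volume_superlevel_rearrangement hg hlt hBfin
    have key := sq_le_lintegral_exit_pairs (A := {x | a i ≤ g x}) (B := {x | a (i + 1) < g x})
      (measurableSet_le measurable_const hg) (measurableSet_lt measurable_const hg)
      (fun x hx => lt_of_lt_of_le hlt hx) hBfin hh
      (le_trans (ENNReal.ofReal_le_ofReal (by nlinarith [Nat.cast_nonneg (α := ℝ) i])) hAge)
      (by
        refine hBle.trans (le_trans ?_ (add_le_add hAge le_rfl))
        rw [← ENNReal.ofReal_add (by positivity) hh.le]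
        exact ENNReal.ofReal_le_ofReal (by linarith))
    calc _ ≤ (a i - a (i + 1)) ^ p * ∫⁻ u in Set.Ioo 0 (4 * h), ∫⁻ x,
          {x | x ∈ {x | a i ≤ g x} ∧ x + u ∉ {x | a (i + 1) < g x}}.indicator 1 x := by
          rw [mul_comm]; gcongr
      _ ≤ ∫⁻ u in Set.Ioo 0 (4 * h), (a i - a (i + 1)) ^ p * ∫⁻ x,
          {x | x ∈ {x | a i ≤ g x} ∧ x + u ∉ {x | a (i + 1) < g x}}.indicator 1 x :=
          lintegral_const_mul_le _ _
      _ ≤ _ := by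
          refine lintegral_mono fun u => (lintegral_const_mul_le _ _).trans ?_
          refine lintegral_mono fun x => ?_
          simp only [Set.indicator_apply, Set.mem_ofPred_eq, not_lt, Pi.one_apply]
          split_ifs <;> simp
  rw [← ENNReal.tsum_mul_left]
  calc _ ≤ ∑' i, ∫⁻ u in Set.Ioo 0 (4 * h), ∫⁻ x,
        (if a i ≤ g x ∧ g (x + u) ≤ a (i + 1) then (a i - a (i + 1)) ^ p else 0) :=
        ENNReal.tsum_le_tsum hterm
    _ = ∫⁻ u in Set.Ioo 0 (4 * h), ∫⁻ x,
        ∑' i, (if a i ≤ g x ∧ g (x + u) ≤ a (i + 1) then (a i - a (i + 1)) ^ p else 0) := by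
        have hm : ∀ i, Measurable fun z : ℝ × ℝ =>
            (if a i ≤ g z.2 ∧ g (z.2 + z.1) ≤ a (i + 1) then (a i - a (i + 1)) ^ p else 0) := by
          intro i
          refine Measurable.ite ?_ measurable_const measurable_const
          have h1 : Measurable fun z : ℝ × ℝ => g z.2 := by fun_prop
          have h2 : Measurable fun z : ℝ × ℝ => g (z.2 + z.1) := by fun_prop
          exact (measurableSet_le measurable_const h1).inter (measurableSet_le h2 measurable_const)
        rw [← lintegral_tsum fun i => (hm i).lintegral_prod_right'.aemeasurable]
        refine lintegral_congr fun u => ?_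
        exact (lintegral_tsum fun i =>
          ((hm i).comp (measurable_prodMk_left (x := u))).aemeasurable).symm
    _ ≤ _ := lintegral_mono fun u => lintegral_mono fun x =>
        tsum_level_gaps_rpow_le ha (g x) (g (x + u)) hp

/-- Power-mean inequality for N + 3 terms normalized by N + 1; the mismatch is absorbed by N + 3 ≤
3(N + 1). -/
lemma mean_rpow_le {ι : Type*} (s : Finset ι) (f : ι → ℝ≥0∞) {N : ℕ}
    (hs : s.card = N + 3) {p : ℝ} (hp : 1 ≤ p) :
    (((N + 1 : ℕ) : ℝ≥0∞)⁻¹ * ∑ i ∈ s, f i) ^ p ≤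
      3 ^ (p - 1) * ((N + 1 : ℕ) : ℝ≥0∞)⁻¹ * ∑ i ∈ s, f i ^ p := by
  set M : ℝ≥0∞ := ((N + 1 : ℕ) : ℝ≥0∞) with hM
  have hM0 : M ≠ 0 := by simp [hM]
  have hMt : M ≠ ∞ := ENNReal.natCast_ne_top _
  have hp1 : 0 ≤ p - 1 := by linarith
  have hcard : ((N + 3 : ℕ) : ℝ≥0∞) ≤ 3 * M := by
    rw [hM]; exact_mod_cast (by omega : N + 3 ≤ 3 * (N + 1))
  rw [ENNReal.mul_rpow_of_nonneg _ _ (by linarith)]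
  calc M⁻¹ ^ p * (∑ i ∈ s, f i) ^ p
      ≤ M⁻¹ ^ p * ((3 * M) ^ (p - 1) * ∑ i ∈ s, f i ^ p) := by
        gcongr
        refine (ENNReal.rpow_sum_le_const_mul_sum_rpow s f hp).trans ?_
        rw [hs]
        gcongr
    _ = 3 ^ (p - 1) * M⁻¹ * ∑ i ∈ s, f i ^ p := by
        rw [← mul_assoc]
        congr 1
        have h1 : M⁻¹ ^ p = M⁻¹ ^ (p - 1) * M⁻¹ := by
          conv_lhs => rw [show p = (p - 1) + 1 by ring]
          rw [ENNReal.rpow_add_of_nonneg _ _ hp1 zero_le_one, ENNReal.rpow_one]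
        rw [h1, ENNReal.mul_rpow_of_nonneg _ _ hp1]
        calc M⁻¹ ^ (p - 1) * M⁻¹ * (3 ^ (p - 1) * M ^ (p - 1))
            = 3 ^ (p - 1) * M⁻¹ * (M⁻¹ ^ (p - 1) * M ^ (p - 1)) := by ring
          _ = _ := by
            rw [← ENNReal.mul_rpow_of_nonneg _ _ hp1, ENNReal.inv_mul_cancel hM0 hMt,
              ENNReal.one_rpow, mul_one]

/-- With N + 1 = ⌊t/h⌋, the interval [t, 2t] is covered by the N + 3 grid cells from (N+1)h to
(2N+4)h, and h/t ≤ 1/(N+1). The weighted gap is thus dominated by a mean of grid gaps. The right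
side is a sum over all i, with coefficients free of N, so that it can be integrated in t term by
term. -/
lemma weighted_doubling_gap_le (g : ℝ → ℝ≥0∞) {h t : ℝ} (hh : 0 < h) (ht : h ≤ t) {p : ℝ}
    (hp : 1 ≤ p) :
    (ENNReal.ofReal (h / t) * (rearrangement g t - rearrangement g (2 * t))) ^ p ≤
      ∑' i : ℕ, 3 ^ p * (rearrangement g ((i + 1) * h) - rearrangement g ((i + 2) * h)) ^ p *
        ((i + 1 : ℕ) : ℝ≥0∞)⁻¹ * (Set.Ico h ((i + 2) * h)).indicator 1 t := by
  set a : ℕ → ℝ≥0∞ := fun i => rearrangement g ((i + 1) * h) with hadef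
  have ha : Antitone a := fun i j hij => rearrangement_antitone g (by
    have : (i : ℝ) ≤ j := by exact_mod_cast hij
    gcongr)
  have hsucc : ∀ i : ℕ, rearrangement g ((i + 2) * h) = a (i + 1) := fun i => by
    simp only [hadef]; push_cast; ring_nf
  simp_rw [hsucc]
  have ht0 : 0 < t := hh.trans_le ht
  obtain ⟨N, hN⟩ : ∃ N, ⌊t / h⌋₊ = N + 1 :=
    Nat.exists_eq_succ_of_ne_zero (Nat.floor_pos.2 ((one_le_div hh).2 ht)).ne'
  have hlow : ((N : ℝ) + 1) * h ≤ t := by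
    have := Nat.floor_le (div_nonneg ht0.le hh.le)
    rw [hN, le_div_iff₀ hh] at this
    exact_mod_cast this
  have hhigh : t < ((N : ℝ) + 2) * h := by
    have := Nat.lt_floor_add_one (t / h)
    rw [hN, div_lt_iff₀ hh] at this
    push_cast at this
    linarith
  have hgap : rearrangement g t - rearrangement g (2 * t) ≤
      ∑ i ∈ Finset.range (N + 3), (a (N + i) - a (N + i + 1)) := by
    have := sum_range_tsub_succ_eq (c := fun i => a (N + i)) (fun i j hij => ha (by omega)) (N + 3)
    simp only [← add_assoc] at this
    rw [this]
    refine tsub_le_tsub (rearrangement_antitone g (by simpa using hlow))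
      (rearrangement_antitone g ?_)
    push_cast
    linarith
  have hfac : ENNReal.ofReal (h / t) ≤ ((N + 1 : ℕ) : ℝ≥0∞)⁻¹ := by
    rw [← ENNReal.ofReal_natCast, ← ENNReal.ofReal_inv_of_pos (by positivity)]
    refine ENNReal.ofReal_le_ofReal ?_
    rw [div_le_iff₀ ht0, inv_mul_eq_div, le_div_iff₀ (by positivity)]
    push_cast
    linarith
  calc _ ≤ (((N + 1 : ℕ) : ℝ≥0∞)⁻¹ *
        ∑ i ∈ Finset.range (N + 3), (a (N + i) - a (N + i + 1))) ^ p := by gcongr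
    _ ≤ 3 ^ (p - 1) * ((N + 1 : ℕ) : ℝ≥0∞)⁻¹ *
        ∑ i ∈ Finset.range (N + 3), (a (N + i) - a (N + i + 1)) ^ p :=
        mean_rpow_le _ _ (Finset.card_range _) hp
    _ ≤ ∑ i ∈ Finset.range (N + 3), 3 ^ p * (a (N + i) - a (N + i + 1)) ^ p *
        ((N + i + 1 : ℕ) : ℝ≥0∞)⁻¹ *
          (Set.Ico h (((N + i : ℕ) + 2) * h)).indicator 1 t := by
        rw [Finset.mul_sum]
        refine Finset.sum_le_sum fun i hi => ?_
        have hi' : i < N + 3 := Finset.mem_range.1 hi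
        have hmem : t ∈ Set.Ico h (((N + i : ℕ) + 2) * h) := by
          refine ⟨ht, hhigh.trans_le ?_⟩
          have : (0 : ℝ) ≤ i := Nat.cast_nonneg i
          push_cast
          gcongr
          linarith
        rw [Set.indicator_of_mem hmem, Pi.one_apply, mul_one]
        -- Here i ≤ N + 2, so the cell index N + i is comparable with N and the coefficient can be
        -- written in terms of the cell alone.
        have h3 : ((N + 1 : ℕ) : ℝ≥0∞)⁻¹ ≤ 3 * ((N + i + 1 : ℕ) : ℝ≥0∞)⁻¹ := by
          rw [← div_eq_mul_inv, ENNReal.le_div_iff_mul_le (by simp) (by simp), mul_comm,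
            ← div_eq_mul_inv, ENNReal.div_le_iff_le_mul (by simp) (by simp)]
          exact_mod_cast (by omega : N + i + 1 ≤ 3 * (N + 1))
        have h4 : (3 : ℝ≥0∞) ^ p = 3 ^ (p - 1) * 3 := by
          conv_lhs => rw [show p = (p - 1) + 1 by ring]
          rw [ENNReal.rpow_add_of_nonneg _ _ (by linarith) zero_le_one, ENNReal.rpow_one]
        calc _ ≤ 3 ^ (p - 1) * (3 * ((N + i + 1 : ℕ) : ℝ≥0∞)⁻¹) *
              (a (N + i) - a (N + i + 1)) ^ p := by gcongr
          _ = _ := by rw [h4]; ring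
    _ ≤ _ := by
        have hinj : Function.Injective fun i : ℕ => N + i := fun i j hij => by simpa using hij
        refine (Finset.sum_map (Finset.range (N + 3)) ⟨fun i : ℕ => N + i, hinj⟩
          (fun i : ℕ => 3 ^ p * (a i - a (i + 1)) ^ p * ((i + 1 : ℕ) : ℝ≥0∞)⁻¹ *
            (Set.Ico h ((i + 2) * h)).indicator 1 t)).symm.le.trans ?_
        exact ENNReal.sum_le_tsum _

theorem lintegral_weighted_doubling_gap_le {g : ℝ → ℝ≥0∞} (hg : Measurable g) {h : ℝ} (hh : 0 < h)
    {p : ℝ} (hp : 1 ≤ p) :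
    ∫⁻ t in Set.Ici h,
        (ENNReal.ofReal (h / t) * (rearrangement g t - rearrangement g (2 * t))) ^ p ≤
      3 ^ p * ENNReal.ofReal h⁻¹ * ∫⁻ u in Set.Ioo 0 (4 * h), ∫⁻ x, (g x - g (x + u)) ^ p := by
  set e : ℕ → ℝ≥0∞ := fun i =>
    (rearrangement g ((i + 1) * h) - rearrangement g ((i + 2) * h)) ^ p with he
  calc _ ≤ ∫⁻ t in Set.Ici h, ∑' i : ℕ, 3 ^ p * e i *
        ((i + 1 : ℕ) : ℝ≥0∞)⁻¹ * (Set.Ico h ((i + 2) * h)).indicator 1 t :=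
        setLIntegral_mono' measurableSet_Ici fun t ht => weighted_doubling_gap_le g hh ht hp
    _ ≤ ∫⁻ t, ∑' i : ℕ, 3 ^ p * e i *
        ((i + 1 : ℕ) : ℝ≥0∞)⁻¹ * (Set.Ico h ((i + 2) * h)).indicator 1 t :=
        setLIntegral_le_lintegral _ _
    _ = ∑' i : ℕ, 3 ^ p * e i * ENNReal.ofReal h := by
        rw [lintegral_tsum fun i => ((measurable_one.indicator measurableSet_Ico).const_mul
          _).aemeasurable]
        refine tsum_congr fun i => ?_
        rw [lintegral_const_mul _ (measurable_one.indicator measurableSet_Ico),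
          -- The i-th interval has length (i+1)h, which cancels the coefficient 1/(i+1): every gap
          -- receives the same mass h.
          lintegral_indicator_one measurableSet_Ico, Real.volume_Ico,
          show ((i : ℝ) + 2) * h - h = ((i + 1 : ℕ) : ℝ) * h by push_cast; ring,
          ENNReal.ofReal_mul (Nat.cast_nonneg _), ENNReal.ofReal_natCast, mul_assoc (3 ^ p * e i),
          ← mul_assoc (((i + 1 : ℕ) : ℝ≥0∞)⁻¹),
          ENNReal.inv_mul_cancel (by simp) (ENNReal.natCast_ne_top _), one_mul]
    _ = 3 ^ p * ENNReal.ofReal h⁻¹ * (ENNReal.ofReal (h ^ 2) * ∑' i, e i) := by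
        rw [ENNReal.tsum_mul_right, ENNReal.tsum_mul_left]
        have : ENNReal.ofReal h = ENNReal.ofReal h⁻¹ * ENNReal.ofReal (h ^ 2) := by
          rw [← ENNReal.ofReal_mul (by positivity)]
          congr 1
          field_simp
        rw [this]
        ring
    _ ≤ _ := by
        gcongr
        exact sq_mul_tsum_rearrangement_gaps_le hg hh hp

end Translates

/-! ### Rearrangement in one variable on ℝ^n: measurability, commutation, contraction, monotonicity.
-/

section PartialRearrangement

variable {n : ℕ}

lemma lintegral_le_of_fibre_le (k : Fin n) {f g : (Fin n → ℝ) → ℝ≥0∞} (hf : Measurable f)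
    (hg : Measurable g) (h : ∀ x : Fin n → ℝ, ∫⁻ s, f (Function.update x k s) ≤
      ∫⁻ s, g (Function.update x k s)) : ∫⁻ x, f x ≤ ∫⁻ x, g x := by
  refine lintegral_le_of_lmarginal_le (μ := fun _ : Fin n => (volume : Measure ℝ)) {k} hf hg ?_
  intro x
  rw [lmarginal_singleton, lmarginal_singleton]
  exact h x

/-- Rational levels suffice in the infimum defining the rearrangement, so sublevel sets are
countable unions of conditions on the fibre distribution function, which is measurable by Fubini. -/
lemma measurable_partialRearrangement (k : Fin n) {g : (Fin n → ℝ) → ℝ≥0∞} (hg : Measurable g) :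
    Measurable (partialRearrangement k g) := by
  have hpos : MeasurableSet {x : Fin n → ℝ | 0 < x k} :=
    measurableSet_lt measurable_const (measurable_pi_apply k)
  refine Measurable.ite hpos ?_ measurable_const
  refine measurable_of_Iio fun a => ?_
  have hset : (fun x : Fin n → ℝ => rearrangement (fun s => g (Function.update x k s)) (x k)) ⁻¹'
      Set.Iio a = ⋃ r : ℚ, {x | (Real.toNNReal r : ℝ≥0∞) < a ∧
        distribution (fun s => g (Function.update x k s)) (Real.toNNReal r : ℝ≥0∞) <
          ENNReal.ofReal (x k)} := by
    ext x
    simp only [Set.mem_preimage, Set.mem_Iio, Set.mem_iUnion, Set.mem_ofPred_eq]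
    constructor
    · intro h
      obtain ⟨y, hy, hya⟩ := sInf_lt_iff.1 h
      obtain ⟨r, -, h1, h2⟩ := ENNReal.lt_iff_exists_rat_btwn.1 hya
      exact ⟨r, h2, lt_of_le_of_lt (distribution_antitone _ h1.le) hy⟩
    · rintro ⟨r, h1, h2⟩
      exact lt_of_le_of_lt (sInf_le h2) h1
  rw [hset]
  refine MeasurableSet.iUnion fun r => ?_
  refine (MeasurableSet.const _).inter (measurableSet_lt ?_
    (ENNReal.measurable_ofReal.comp (measurable_pi_apply k)))
  have hS : MeasurableSet {z : (Fin n → ℝ) × ℝ |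
      (Real.toNNReal r : ℝ≥0∞) < g (Function.update z.1 k z.2)} :=
    measurableSet_lt measurable_const (hg.comp measurable_update')
  exact measurable_measure_prodMk_left hS

/-- By Fubini almost every fibre meets the exceptional null set in a null set, and on such a fibre
the two rearrangements coincide. -/
lemma partialRearrangement_congr_ae (k : Fin n) {g h : (Fin n → ℝ) → ℝ≥0∞}
    (hgh : g =ᵐ[volume] h) : partialRearrangement k g =ᵐ[volume] partialRearrangement k h := by
  obtain ⟨M, hsub, hM, hM0⟩ := exists_measurable_superset_of_null (ae_iff.1 hgh)
  set m : (Fin n → ℝ) → ℝ≥0∞ := fun x => volume {s : ℝ | Function.update x k s ∈ M} with hm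
  have hS : MeasurableSet {z : (Fin n → ℝ) × ℝ | Function.update z.1 k z.2 ∈ M} :=
    measurable_update' hM
  have hmm : Measurable m := measurable_measure_prodMk_left hS
  have hB : MeasurableSet {x | m x ≠ 0} := (hmm (measurableSet_singleton 0)).compl
  have hB0 : volume {x | m x ≠ 0} = 0 := by
    -- The set of bad points is invariant along the k-th direction, so its indicator has fibre
    -- integral 0 or ∞; the factor ∞ makes the fibrewise comparison with M hold.
    have key : ∫⁻ x, {x | m x ≠ 0}.indicator 1 x ≤ ∫⁻ x, ∞ * M.indicator 1 x := by
      refine lintegral_le_of_fibre_le k (measurable_one.indicator hB)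
        ((measurable_one.indicator hM).const_mul _) fun x => ?_
      rw [lintegral_const_mul _ (by
        exact (measurable_one.indicator hM).comp (measurable_update x))]
      have h1 : ∫⁻ s, M.indicator (1 : (Fin n → ℝ) → ℝ≥0∞) (Function.update x k s) = m x := by
        exact lintegral_indicator_one (measurable_update x hM)
      rw [h1]
      by_cases h0 : m x = 0
      · have : ∀ s, m (Function.update x k s) = 0 := fun s => by simpa [hm] using h0
        simp [this, h0]
      · rw [ENNReal.top_mul h0]; exact le_top
    rw [lintegral_indicator_one hB, lintegral_const_mul _ (measurable_one.indicator hM),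
      lintegral_indicator_one hM, hM0, mul_zero] at key
    exact le_antisymm key bot_le
  refine (ae_iff.2 hB0 : ∀ᵐ x, m x = 0).mono fun x hx => ?_
  have hae : (fun s => g (Function.update x k s)) =ᵐ[volume]
      fun s => h (Function.update x k s) := by
    refine measure_mono_null (fun s hs => ?_) hx
    exact hsub hs
  simp only [partialRearrangement, rearrangement_congr_ae hae]

/-- Apply `ψ` to the `k`-th coordinate. -/
def coordMap (k : Fin n) (ψ : ℝ → ℝ) (x : Fin n → ℝ) : Fin n → ℝ := Function.update x k (ψ (x k))

lemma measurable_coordMap (k : Fin n) {ψ : ℝ → ℝ} (hψ : Measurable ψ) :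
    Measurable (coordMap k ψ) :=
  measurable_update'.comp (measurable_id.prodMk (hψ.comp (measurable_pi_apply k)))

lemma coordMap_update (k : Fin n) (ψ : ℝ → ℝ) (x : Fin n → ℝ) (s : ℝ) :
    coordMap k ψ (Function.update x k s) = Function.update x k (ψ s) := by
  simp [coordMap]

lemma partialRearrangement_comp_coordMap {j k : Fin n} (hjk : j ≠ k) (ψ : ℝ → ℝ)
    (g : (Fin n → ℝ) → ℝ≥0∞) :
    partialRearrangement j (g ∘ coordMap k ψ) = partialRearrangement j g ∘ coordMap k ψ := by
  funext x
  have h1 : coordMap k ψ x j = x j := by simp [coordMap, hjk]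
  have h2 : ∀ s, coordMap k ψ (Function.update x j s) = Function.update (coordMap k ψ x) j s := by
    intro s
    simp only [coordMap, Function.update_of_ne hjk.symm]
    exact Function.update_comm hjk _ _ _
  simp only [partialRearrangement, Function.comp, h1, h2]

lemma partialRearrangement_zero (k : Fin n) : partialRearrangement k (fun _ => 0) = fun _ => 0 := by
  funext x
  simp only [partialRearrangement]
  split_ifs with h
  · exact rearrangement_zero h
  · rfl

/-- A weight that does not depend on the rearranged variable is constant on each fibre, so the
one-dimensional contraction applies fibrewise. This lets the weight in the k-th variable survive the
later rearrangements. -/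
lemma lintegral_partialRearrangement_tsub_rpow_le (j : Fin n) {g h W : (Fin n → ℝ) → ℝ≥0∞}
    (hg : Measurable g) (hh : Measurable h) (hW : Measurable W)
    (hWj : ∀ x s, W (Function.update x j s) = W x) {p : ℝ} (hp : 1 ≤ p) :
    ∫⁻ x, W x * (partialRearrangement j g x - partialRearrangement j h x) ^ p ≤
      ∫⁻ x, W x * (g x - h x) ^ p := by
  have hp0 : 0 < p := by linarith
  have hu : ∀ x : Fin n → ℝ, Measurable fun s : ℝ => Function.update x j s :=
    fun x => measurable_update x
  refine lintegral_le_of_fibre_le j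
    (hW.mul (((measurable_partialRearrangement j hg).sub
      (measurable_partialRearrangement j hh)).pow_const p))
    (hW.mul ((hg.sub hh).pow_const p)) fun x => ?_
  simp_rw [hWj]
  rw [lintegral_const_mul _ (by
      exact ((((measurable_partialRearrangement j hg).comp (hu x)).sub
        ((measurable_partialRearrangement j hh).comp (hu x))).pow_const p)),
    lintegral_const_mul _ (by exact ((hg.comp (hu x)).sub (hh.comp (hu x))).pow_const p)]
  refine mul_le_mul' le_rfl (le_trans (le_of_eq ?_)
    (lintegral_rearrangement_tsub_rpow_le (hg.comp (hu x)) (hh.comp (hu x)) hp))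
  rw [← lintegral_indicator measurableSet_Ioi]
  refine lintegral_congr fun s => ?_
  by_cases hs : 0 < s
  · simp [partialRearrangement, hs, Function.comp_def]
  · simp [partialRearrangement, hs, hp0]

/-- Successive partial rearrangement along a list of coordinates. -/
noncomputable def listRearrangement (l : List (Fin n)) (g : (Fin n → ℝ) → ℝ≥0∞) :
    (Fin n → ℝ) → ℝ≥0∞ :=
  l.foldl (fun g k => partialRearrangement k g) g

lemma listRearrangement_cons (k : Fin n) (l : List (Fin n)) (g : (Fin n → ℝ) → ℝ≥0∞) :
    listRearrangement (k :: l) g = listRearrangement l (partialRearrangement k g) := rfl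

lemma measurable_listRearrangement (l : List (Fin n)) {g : (Fin n → ℝ) → ℝ≥0∞}
    (hg : Measurable g) : Measurable (listRearrangement l g) := by
  induction l generalizing g with
  | nil => exact hg
  | cons k l ih => exact ih (measurable_partialRearrangement k hg)

lemma listRearrangement_congr_ae (l : List (Fin n)) {g h : (Fin n → ℝ) → ℝ≥0∞}
    (hgh : g =ᵐ[volume] h) : listRearrangement l g =ᵐ[volume] listRearrangement l h := by
  induction l generalizing g h with
  | nil => exact hgh
  | cons k l ih => exact ih (partialRearrangement_congr_ae k hgh)

lemma listRearrangement_zero (l : List (Fin n)) :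
    listRearrangement l (fun _ => 0) = fun _ => 0 := by
  induction l with
  | nil => rfl
  | cons k l ih => rw [listRearrangement_cons, partialRearrangement_zero, ih]

lemma listRearrangement_comp_coordMap {k : Fin n} {l : List (Fin n)} (hk : k ∉ l) (ψ : ℝ → ℝ)
    (g : (Fin n → ℝ) → ℝ≥0∞) :
    listRearrangement l (g ∘ coordMap k ψ) = listRearrangement l g ∘ coordMap k ψ := by
  induction l generalizing g with
  | nil => rfl
  | cons j l ih =>
    rw [List.mem_cons, not_or] at hk
    rw [listRearrangement_cons, listRearrangement_cons,
      partialRearrangement_comp_coordMap (Ne.symm hk.1), ih hk.2]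

lemma lintegral_listRearrangement_tsub_rpow_le (l : List (Fin n)) {g h W : (Fin n → ℝ) → ℝ≥0∞}
    (hg : Measurable g) (hh : Measurable h) (hW : Measurable W)
    (hWj : ∀ j ∈ l, ∀ x s, W (Function.update x j s) = W x) {p : ℝ} (hp : 1 ≤ p) :
    ∫⁻ x, W x * (listRearrangement l g x - listRearrangement l h x) ^ p ≤
      ∫⁻ x, W x * (g x - h x) ^ p := by
  induction l generalizing g h with
  | nil => exact le_rfl
  | cons j l ih =>
    exact (ih (measurable_partialRearrangement j hg) (measurable_partialRearrangement j hh)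
      fun i hi => hWj i (List.mem_cons_of_mem _ hi)).trans
      (lintegral_partialRearrangement_tsub_rpow_le j hg hh hW (hWj j List.mem_cons_self) hp)

/-- `g` is nonincreasing in the `k`-th variable on the half-space `x k > 0`. -/
def AntitoneCoord (k : Fin n) (g : (Fin n → ℝ) → ℝ≥0∞) : Prop :=
  ∀ x s t, 0 < s → s ≤ t → g (Function.update x k t) ≤ g (Function.update x k s)

lemma antitoneCoord_partialRearrangement_self (k : Fin n) (g : (Fin n → ℝ) → ℝ≥0∞) :
    AntitoneCoord k (partialRearrangement k g) := by
  intro x s t hs hst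
  simp only [partialRearrangement, Function.update_self, hs, hs.trans_le hst, if_true,
    Function.update_idem]
  exact rearrangement_antitone _ hst

lemma AntitoneCoord.partialRearrangement {j k : Fin n} {g : (Fin n → ℝ) → ℝ≥0∞}
    (h : AntitoneCoord k g) : AntitoneCoord k (partialRearrangement j g) := by
  rcases eq_or_ne j k with rfl | hjk
  · exact antitoneCoord_partialRearrangement_self _ _
  intro x s t hs hst
  simp only [AnisoBesov.partialRearrangement, Function.update_of_ne hjk]
  split_ifs
  · refine rearrangement_mono (fun r => ?_) _
    rw [Function.update_comm hjk.symm, Function.update_comm hjk.symm]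
    exact h _ s t hs hst
  · exact le_rfl

lemma AntitoneCoord.listRearrangement {k : Fin n} {g : (Fin n → ℝ) → ℝ≥0∞}
    (h : AntitoneCoord k g) (l : List (Fin n)) : AntitoneCoord k (listRearrangement l g) := by
  induction l generalizing g with
  | nil => exact h
  | cons j l ih => exact ih h.partialRearrangement

lemma antitoneCoord_listRearrangement {k : Fin n} {l : List (Fin n)} (hk : k ∈ l)
    (g : (Fin n → ℝ) → ℝ≥0∞) : AntitoneCoord k (listRearrangement l g) := by
  induction l generalizing g with
  | nil => simp at hk
  | cons j l ih =>
    rcases eq_or_ne k j with rfl | hkj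
    · exact (antitoneCoord_partialRearrangement_self k g).listRearrangement l
    · exact ih (List.mem_of_ne_of_mem hkj hk) _

/-- The coordinates are lowered from t to s one at a time. -/
lemma le_of_antitoneCoord {g : (Fin n → ℝ) → ℝ≥0∞} (hg : ∀ k, AntitoneCoord k g)
    {s t : Fin n → ℝ} (hs : ∀ i, 0 < s i) (hst : s ≤ t) : g t ≤ g s := by
  have key : ∀ A : Finset (Fin n), g t ≤ g (fun i => if i ∈ A then s i else t i) := by
    intro A
    induction A using Finset.induction_on with
    | empty => simp
    | insert a A ha ih =>
      refine ih.trans ?_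
      have h1 := hg a (fun i => if i ∈ A then s i else t i) (s a) (t a) (hs a) (hst a)
      have e1 : Function.update (fun i => if i ∈ A then s i else t i) a (t a) =
          fun i => if i ∈ A then s i else t i := by
        conv_rhs => rw [← Function.update_eq_self a (fun i => if i ∈ A then s i else t i)]
        simp [ha]
      have e2 : Function.update (fun i => if i ∈ A then s i else t i) a (s a) =
          fun i => if i ∈ insert a A then s i else t i := by
        funext i
        rcases eq_or_ne i a with rfl | hi
        · simp
        · simp [hi]
      rwa [e1, e2] at h1
  simpa using key Finset.univ

end PartialRearrangement

/-! ### Doubling differences of the iterated rearrangement versus moduli of continuity. -/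

section DoublingDifference

variable {n : ℕ}

/-- The weight `t ↦ (δ / t) 1_{t ≥ δ}`. -/
noncomputable def tailWeight (δ t : ℝ) : ℝ≥0∞ :=
  (Set.Ici δ).indicator (fun t => ENNReal.ofReal (δ / t)) t

lemma measurable_tailWeight (δ : ℝ) : Measurable (tailWeight δ) :=
  Measurable.indicator (by fun_prop) measurableSet_Ici

/-- The grid step is h = δ/4, so that the shifts range over (0, δ). Replacing h/t by δ/t costs 4^p,
and 1/h = 4/δ. -/
lemma lintegral_tailWeight_rearrangement_le {g : ℝ → ℝ≥0∞} (hg : Measurable g) {δ : ℝ}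
    (hδ : 0 < δ) {p : ℝ} (hp : 1 ≤ p) :
    ∫⁻ t, (tailWeight δ t * (rearrangement g t - rearrangement g (2 * t))) ^ p ≤
      4 * 12 ^ p * ENNReal.ofReal δ⁻¹ * ∫⁻ u in Set.Ioo 0 δ, ∫⁻ x, (g x - g (x + u)) ^ p := by
  have hp0 : 0 < p := by linarith
  have h4 : (0 : ℝ) < δ / 4 := by linarith
  have key := lintegral_weighted_doubling_gap_le hg h4 hp
  rw [show 4 * (δ / 4) = δ by ring] at key
  calc _ ≤ ∫⁻ t, (Set.Ici (δ / 4)).indicator (fun t => 4 ^ p *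
        (ENNReal.ofReal (δ / 4 / t) * (rearrangement g t - rearrangement g (2 * t))) ^ p) t := by
        refine lintegral_mono fun t => ?_
        by_cases ht : δ ≤ t
        · rw [Set.indicator_of_mem (show t ∈ Set.Ici (δ / 4) from le_trans (by linarith) ht),
            tailWeight, Set.indicator_of_mem (show t ∈ Set.Ici δ from ht),
            ← ENNReal.mul_rpow_of_nonneg _ _ hp0.le, ← mul_assoc]
          refine le_of_eq ?_
          congr 2
          rw [show (4 : ℝ≥0∞) = ENNReal.ofReal 4 by simp, ← ENNReal.ofReal_mul (by norm_num)]
          congr 1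
          ring
        · rw [tailWeight, Set.indicator_of_notMem (show t ∉ Set.Ici δ from ht), zero_mul,
            ENNReal.zero_rpow_of_pos hp0]
          exact bot_le
    _ = 4 ^ p * ∫⁻ t in Set.Ici (δ / 4),
        (ENNReal.ofReal (δ / 4 / t) * (rearrangement g t - rearrangement g (2 * t))) ^ p := by
        rw [lintegral_indicator measurableSet_Ici, lintegral_const_mul]
        have h1 := measurable_rearrangement g
        fun_prop
    _ ≤ 4 ^ p * (3 ^ p * ENNReal.ofReal (δ / 4)⁻¹ *
        ∫⁻ u in Set.Ioo 0 δ, ∫⁻ x, (g x - g (x + u)) ^ p) := by gcongr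
    _ = _ := by
        have e1 : (12 : ℝ≥0∞) ^ p = 4 ^ p * 3 ^ p := by
          rw [← ENNReal.mul_rpow_of_nonneg _ _ hp0.le]; norm_num
        have e2 : ENNReal.ofReal (δ / 4)⁻¹ = 4 * ENNReal.ofReal δ⁻¹ := by
          rw [show (4 : ℝ≥0∞) = ENNReal.ofReal 4 by simp, ← ENNReal.ofReal_mul (by norm_num)]
          congr 1
          field_simp
        rw [e1, e2]; ring

lemma lintegral_tailWeight_partialRearrangement_le (k : Fin n) {G : (Fin n → ℝ) → ℝ≥0∞}
    (hG : Measurable G) {δ : ℝ} (hδ : 0 < δ) {p : ℝ} (hp : 1 ≤ p) :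
    ∫⁻ x, (tailWeight δ (x k) * (partialRearrangement k G x -
        partialRearrangement k G (coordMap k (2 * ·) x))) ^ p ≤
      4 * 12 ^ p * ENNReal.ofReal δ⁻¹ *
        ∫⁻ u in Set.Ioo 0 δ, ∫⁻ x, (G x - G (coordMap k (· + u) x)) ^ p := by
  have hp0 : 0 < p := by linarith
  have hR := measurable_partialRearrangement k hG
  have h2 : Measurable (coordMap k (2 * ·)) := measurable_coordMap k (by fun_prop)
  have hT : Measurable fun z : (Fin n → ℝ) × ℝ => coordMap k (· + z.2) z.1 := by
    simp only [coordMap]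
    exact measurable_update'.comp (measurable_fst.prodMk
      (((measurable_pi_apply k).comp measurable_fst).add measurable_snd))
  have hD : Measurable fun z : (Fin n → ℝ) × ℝ => (G z.1 - G (coordMap k (· + z.2) z.1)) ^ p :=
    ((hG.comp measurable_fst).sub (hG.comp hT)).pow_const p
  rw [lintegral_lintegral_swap (by
      exact (hD.comp measurable_swap).aemeasurable),
    ← lintegral_const_mul _ hD.lintegral_prod_right']
  refine lintegral_le_of_fibre_le k
    (((measurable_tailWeight δ).comp (measurable_pi_apply k)).mul
      (hR.sub (hR.comp h2)) |>.pow_const p) (hD.lintegral_prod_right'.const_mul _) fun x => ?_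
  have hu : Measurable fun s : ℝ => Function.update x k s := measurable_update x
  have key := lintegral_tailWeight_rearrangement_le (hG.comp hu) hδ hp
  calc _ = ∫⁻ t, (tailWeight δ t * (rearrangement (G ∘ fun s => Function.update x k s) t -
        rearrangement (G ∘ fun s => Function.update x k s) (2 * t))) ^ p := by
        refine lintegral_congr fun t => ?_
        by_cases ht : δ ≤ t
        · have ht0 : 0 < t := hδ.trans_le ht
          simp [coordMap_update, partialRearrangement, ht0, Function.comp_def]
        · simp [tailWeight, Set.indicator_of_notMem (show t ∉ Set.Ici δ from ht), hp0]
    _ ≤ _ := key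
    _ = _ := by
        rw [lintegral_const_mul _ (by exact hD.lintegral_prod_right'.comp hu),
          lintegral_lintegral_swap (by
            refine Measurable.aemeasurable ?_
            exact (((hG.comp hu).comp measurable_snd).sub
              ((hG.comp hu).comp (measurable_snd.add measurable_fst))).pow_const p)]
        simp only [coordMap_update, Function.comp_apply]

lemma coordMap_add_eq (k : Fin n) (u : ℝ) (x : Fin n → ℝ) :
    coordMap k (· + u) x = x + Pi.single k u := by
  funext i
  rcases eq_or_ne i k with rfl | hi
  · simp [coordMap]
  · simp [coordMap, hi]

lemma lintegral_enorm_tsub_translate_le {f : (Fin n → ℝ) → ℝ} (k : Fin n) {p : ℝ} (hp : 1 ≤ p)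
    {δ u : ℝ} (hu : |u| ≤ δ) :
    ∫⁻ x, (‖f x‖ₑ - ‖f (coordMap k (· + u) x)‖ₑ) ^ p ≤ partialModulus p k f δ ^ p := by
  have hp0 : 0 < p := by linarith
  have h1 : eLpNorm (fun x => f (x + Pi.single k u) - f x) (ENNReal.ofReal p) volume ≤
      partialModulus p k f δ := by
    unfold partialModulus
    exact le_iSup₂_of_le u hu le_rfl
  refine le_trans ?_ (ENNReal.rpow_le_rpow h1 hp0.le)
  rw [eLpNorm_eq_lintegral_rpow_enorm_toReal (ENNReal.ofReal_pos.2 hp0).ne' ENNReal.ofReal_ne_top,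
    ENNReal.toReal_ofReal hp0.le, ← ENNReal.rpow_mul, one_div_mul_cancel hp0.ne', ENNReal.rpow_one]
  refine lintegral_mono fun x => ENNReal.rpow_le_rpow ?_ hp0.le
  rw [coordMap_add_eq, tsub_le_iff_right]
  have h2 := enorm_sub_le (a := f (x + Pi.single k u)) (b := f (x + Pi.single k u) - f x)
  rw [sub_sub_cancel] at h2
  rwa [add_comm]

/-- The dyadic differences of the iterated rearrangement in the `k`-th variable are controlled by
the partial modulus of continuity, simultaneously on all scales larger than `δ`. -/
theorem lintegral_tailWeight_iteratedRearrangement_le {f : (Fin n → ℝ) → ℝ} (hf : Measurable f)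
    (σ : Equiv.Perm (Fin n)) (k : Fin n) {δ : ℝ} (hδ : 0 < δ) {p : ℝ} (hp : 1 ≤ p) :
    ∫⁻ x, (tailWeight δ (x k) * (iteratedRearrangement σ f x -
        iteratedRearrangement σ f (coordMap k (2 * ·) x))) ^ p ≤
      4 * 12 ^ p * partialModulus p k f δ ^ p := by
  have hp0 : 0 < p := by linarith
  have hmem : k ∈ List.ofFn σ := List.mem_ofFn.2 (σ.surjective k)
  have hnd : (List.ofFn σ).Nodup := List.nodup_ofFn.2 σ.injective
  -- The variable k is rearranged exactly once. The rearrangements after it (`l₂`) commute with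
  -- doubling of x_k, and those before it (`l₁`) commute with translation in x_k; both contract.
  obtain ⟨l₁, l₂, hl⟩ := List.append_of_mem hmem
  rw [hl] at hnd
  have hk₁ : k ∉ l₁ := fun h => (List.nodup_append.1 hnd).2.2 k h k List.mem_cons_self rfl
  have hk₂ : k ∉ l₂ := (List.nodup_cons.1 (List.nodup_append.1 hnd).2.1).1
  set G := listRearrangement l₁ (fun x => ‖f x‖ₑ) with hGdef
  have hfm : Measurable fun x => ‖f x‖ₑ := hf.enorm
  have hG : Measurable G := measurable_listRearrangement _ hfm
  have hF : iteratedRearrangement σ f = listRearrangement l₂ (partialRearrangement k G) := by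
    simp only [iteratedRearrangement, hl, List.foldl_append, List.foldl_cons]
    rfl
  have h2 : Measurable (coordMap k (2 * ·)) := measurable_coordMap k (by fun_prop)
  have hR := measurable_partialRearrangement k hG
  have hW : Measurable fun x : Fin n → ℝ => tailWeight δ (x k) ^ p :=
    ((measurable_tailWeight δ).comp (measurable_pi_apply k)).pow_const p
  calc _ = ∫⁻ x, tailWeight δ (x k) ^ p *
        (listRearrangement l₂ (partialRearrangement k G) x -
          listRearrangement l₂ (partialRearrangement k G ∘ coordMap k (2 * ·)) x) ^ p := by
        rw [hF, listRearrangement_comp_coordMap hk₂]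
        simp_rw [ENNReal.mul_rpow_of_nonneg _ _ hp0.le]
        rfl
    _ ≤ ∫⁻ x, tailWeight δ (x k) ^ p * (partialRearrangement k G x -
          (partialRearrangement k G ∘ coordMap k (2 * ·)) x) ^ p := by
        refine lintegral_listRearrangement_tsub_rpow_le l₂ hR (hR.comp h2) hW ?_ hp
        intro j hj x s
        have : k ≠ j := fun h => hk₂ (h ▸ hj)
        simp [Function.update_of_ne this]
    _ = ∫⁻ x, (tailWeight δ (x k) * (partialRearrangement k G x -
        partialRearrangement k G (coordMap k (2 * ·) x))) ^ p := by
        simp_rw [ENNReal.mul_rpow_of_nonneg _ _ hp0.le]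
        rfl
    _ ≤ 4 * 12 ^ p * ENNReal.ofReal δ⁻¹ *
        ∫⁻ u in Set.Ioo 0 δ, ∫⁻ x, (G x - G (coordMap k (· + u) x)) ^ p :=
        lintegral_tailWeight_partialRearrangement_le k hG hδ hp
    _ ≤ 4 * 12 ^ p * ENNReal.ofReal δ⁻¹ *
        ∫⁻ _ in Set.Ioo 0 δ, partialModulus p k f δ ^ p := by
        refine mul_le_mul' le_rfl (setLIntegral_mono' measurableSet_Ioo fun u hu => ?_)
        refine le_trans ?_ (lintegral_enorm_tsub_translate_le k hp (δ := δ) (u := u)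
          (abs_le.2 ⟨by linarith [hu.1], hu.2.le⟩))
        have hu' : Measurable (coordMap (n := n) k (· + u)) := measurable_coordMap k (by fun_prop)
        have := lintegral_listRearrangement_tsub_rpow_le l₁ hfm (hfm.comp hu') (W := fun _ => 1)
          measurable_const (fun _ _ _ _ => rfl) hp
        simp only [one_mul] at this
        rw [listRearrangement_comp_coordMap hk₁] at this
        exact this
    _ = _ := by
        rw [setLIntegral_const, Real.volume_Ioo, sub_zero]
        have : ENNReal.ofReal δ⁻¹ * ENNReal.ofReal δ = 1 := by
          rw [← ENNReal.ofReal_mul (by positivity), inv_mul_cancel₀ hδ.ne', ENNReal.ofReal_one]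
        calc _ = 4 * 12 ^ p * partialModulus p k f δ ^ p *
              (ENNReal.ofReal δ⁻¹ * ENNReal.ofReal δ) := by ring
          _ = _ := by rw [this, mul_one]

lemma measurable_iteratedRearrangement {f : (Fin n → ℝ) → ℝ} (hf : Measurable f)
    (σ : Equiv.Perm (Fin n)) : Measurable (iteratedRearrangement σ f) :=
  measurable_listRearrangement _ hf.enorm

lemma iteratedRearrangement_congr_ae {f g : (Fin n → ℝ) → ℝ} (hfg : f =ᵐ[volume] g)
    (σ : Equiv.Perm (Fin n)) :
    iteratedRearrangement σ f =ᵐ[volume] iteratedRearrangement σ g :=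
  listRearrangement_congr_ae _ (hfg.fun_comp (fun y => ‖y‖ₑ))

lemma iteratedRearrangement_antitone (σ : Equiv.Perm (Fin n)) (f : (Fin n → ℝ) → ℝ)
    {s t : Fin n → ℝ} (hs : ∀ i, 0 < s i) (hst : s ≤ t) :
    iteratedRearrangement σ f t ≤ iteratedRearrangement σ f s :=
  le_of_antitoneCoord
    (fun k => antitoneCoord_listRearrangement (List.mem_ofFn.2 (σ.surjective k)) _) hs hst

lemma lintegral_iteratedRearrangement_rpow_le {f : (Fin n → ℝ) → ℝ} (hf : Measurable f)
    (σ : Equiv.Perm (Fin n)) {p : ℝ} (hp : 1 ≤ p) :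
    ∫⁻ x, iteratedRearrangement σ f x ^ p ≤ ∫⁻ x, ‖f x‖ₑ ^ p := by
  have := lintegral_listRearrangement_tsub_rpow_le (List.ofFn σ) hf.enorm
    (measurable_const (a := (0 : ℝ≥0∞))) (W := fun _ => 1) measurable_const
    (fun _ _ _ _ => rfl) hp
  rw [listRearrangement_zero] at this
  simp only [one_mul, tsub_zero] at this
  exact this

end DoublingDifference

/-! ### Slowly varying majorants, path iteration and Hölder's inequality on ℤ^n. -/

section Lattice

variable {n : ℕ}

/-- The exponential weight `2^{-ε |ξ|₁}` on `ℤ^n`. -/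
noncomputable def latticeWeight (ε : ℝ) (ξ : Fin n → ℤ) : ℝ≥0∞ :=
  ∏ i, (2 : ℝ≥0∞) ^ (-(ε * |(ξ i : ℝ)|))

/-- The least majorant of `z` whose logarithm in base `2` is `ε`-Lipschitz for the `ℓ¹` metric. -/
noncomputable def slowMajorant (ε : ℝ) (z : (Fin n → ℤ) → ℝ≥0∞) (ν : Fin n → ℤ) : ℝ≥0∞ :=
  ⨆ μ, latticeWeight ε (ν - μ) * z μ

lemma latticeWeight_le_one {ε : ℝ} (hε : 0 ≤ ε) (ξ : Fin n → ℤ) : latticeWeight ε ξ ≤ 1 := by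
  refine Finset.prod_le_one' fun i _ => ?_
  calc (2 : ℝ≥0∞) ^ (-(ε * |(ξ i : ℝ)|)) ≤ 2 ^ (0 : ℝ) :=
        ENNReal.rpow_le_rpow_of_exponent_le (by norm_num) (by
          have := mul_nonneg hε (abs_nonneg (ξ i : ℝ)); linarith)
    _ = 1 := ENNReal.rpow_zero

lemma le_slowMajorant (ε : ℝ) (z : (Fin n → ℤ) → ℝ≥0∞) (ν : Fin n → ℤ) :
    z ν ≤ slowMajorant ε z ν := by
  refine le_iSup_of_le ν ?_
  simp [latticeWeight]

lemma latticeWeight_add_single_le {ε : ℝ} (hε : 0 ≤ ε) (ξ : Fin n → ℤ) (k : Fin n) :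
    latticeWeight ε (ξ + Pi.single k 1) ≤ 2 ^ ε * latticeWeight ε ξ := by
  simp only [latticeWeight]
  rw [← Finset.mul_prod_erase _ _ (Finset.mem_univ k), ← Finset.mul_prod_erase _ _
    (Finset.mem_univ k), ← mul_assoc]
  refine mul_le_mul' ?_ (le_of_eq (Finset.prod_congr rfl fun i hi => ?_))
  · rw [← ENNReal.rpow_add _ _ (by norm_num) (by norm_num)]
    refine ENNReal.rpow_le_rpow_of_exponent_le (by norm_num) ?_
    have h : |(ξ k : ℝ)| ≤ |(((ξ + Pi.single k 1 : Fin n → ℤ) k : ℤ) : ℝ)| + 1 := by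
      have := abs_sub_abs_le_abs_sub (ξ k : ℝ) ((ξ k : ℝ) + 1)
      simp at this ⊢
      linarith
    nlinarith
  · simp [Finset.ne_of_mem_erase hi]

lemma slowMajorant_add_single_le {ε : ℝ} (hε : 0 ≤ ε) (z : (Fin n → ℤ) → ℝ≥0∞) (ν : Fin n → ℤ)
    (k : Fin n) : slowMajorant ε z (ν + Pi.single k 1) ≤ 2 ^ ε * slowMajorant ε z ν := by
  refine iSup_le fun μ => ?_
  calc _ ≤ 2 ^ ε * latticeWeight ε (ν - μ) * z μ := by
        gcongr
        rw [add_sub_right_comm]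
        exact latticeWeight_add_single_le hε _ _
    _ = 2 ^ ε * (latticeWeight ε (ν - μ) * z μ) := mul_assoc _ _ _
    _ ≤ _ := by
        gcongr
        exact le_iSup (fun μ => latticeWeight ε (ν - μ) * z μ) μ

lemma slowMajorant_le_of_le {ε : ℝ} (hε : 0 ≤ ε) {z : (Fin n → ℤ) → ℝ≥0∞} {S : ℝ≥0∞}
    (hz : ∀ ν, z ν ≤ S) (ν : Fin n → ℤ) : slowMajorant ε z ν ≤ S :=
  iSup_le fun μ => (mul_le_mul' (latticeWeight_le_one hε _) (hz μ)).trans_eq (one_mul S)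

/-- The supremum is bounded by a sum, which is a convolution. Since the weight is at most 1 and θ ≥
1, its θ-th power is at most itself, so the constant does not depend on θ. -/
lemma tsum_slowMajorant_rpow_le {ε : ℝ} (hε : 0 ≤ ε) (z : (Fin n → ℤ) → ℝ≥0∞) {θ : ℝ}
    (hθ : 1 ≤ θ) :
    ∑' ν, slowMajorant ε z ν ^ θ ≤ (∑' ξ : Fin n → ℤ, latticeWeight ε ξ) * ∑' ν, z ν ^ θ := by
  have hθ0 : 0 < θ := by linarith
  have hpt : ∀ ν, slowMajorant ε z ν ^ θ ≤ ∑' μ, latticeWeight ε (ν - μ) * z μ ^ θ := by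
    intro ν
    rw [← ENNReal.le_rpow_inv_iff hθ0]
    refine iSup_le fun μ => ?_
    rw [ENNReal.le_rpow_inv_iff hθ0, ENNReal.mul_rpow_of_nonneg _ _ hθ0.le]
    refine le_trans ?_ (ENNReal.le_tsum μ)
    gcongr
    exact ENNReal.rpow_le_self_of_le_one (latticeWeight_le_one hε _) hθ
  calc _ ≤ ∑' ν, ∑' μ, latticeWeight ε (ν - μ) * z μ ^ θ := ENNReal.tsum_le_tsum hpt
    _ = ∑' μ, ∑' ν, latticeWeight ε (ν - μ) * z μ ^ θ := ENNReal.tsum_comm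
    _ = ∑' μ, (∑' ξ : Fin n → ℤ, latticeWeight ε ξ) * z μ ^ θ := by
        refine tsum_congr fun μ => ?_
        rw [ENNReal.tsum_mul_right, ← (Equiv.subRight μ).tsum_eq (latticeWeight ε)]
        rfl
    _ = _ := ENNReal.tsum_mul_left

lemma tsum_pi_prod_eq {ι : Type*} (f : ι → ℝ≥0∞) (n : ℕ) :
    ∑' ξ : Fin n → ι, ∏ i, f (ξ i) = (∑' m, f m) ^ n := by
  induction n with
  | zero => simp
  | succ n ih =>
    rw [← (Fin.consEquiv fun _ : Fin (n + 1) => ι).tsum_eq, ENNReal.tsum_prod', pow_succ']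
    simp only [Fin.consEquiv, Equiv.coe_fn_mk, Fin.prod_univ_succ, Fin.cons_zero, Fin.cons_succ]
    simp_rw [ENNReal.tsum_mul_left, ih, ENNReal.tsum_mul_right]

lemma tsum_latticeWeight_ne_top {ε : ℝ} (hε : 0 < ε) :
    ∑' ξ : Fin n → ℤ, latticeWeight ε ξ ≠ ∞ := by
  simp only [latticeWeight]
  rw [tsum_pi_prod_eq (fun m : ℤ => (2 : ℝ≥0∞) ^ (-(ε * |(m : ℝ)|)))]
  refine ENNReal.pow_ne_top ?_
  set r : ℝ≥0∞ := 2 ^ (-ε) with hr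
  have hr1 : r < 1 := ENNReal.rpow_lt_one_of_one_lt_of_neg (by norm_num) (by linarith)
  have hpow : ∀ m : ℕ, (2 : ℝ≥0∞) ^ (-(ε * m)) = r ^ m := fun m => by
    rw [hr, ← ENNReal.rpow_natCast, ← ENNReal.rpow_mul]; ring_nf
  have hgeo : ∑' m : ℕ, r ^ m ≠ ∞ := by
    rw [ENNReal.tsum_geometric]
    exact ENNReal.inv_ne_top.2 (tsub_pos_of_lt hr1).ne'
  rw [tsum_of_nat_of_neg_add_one ENNReal.summable ENNReal.summable]
  refine ENNReal.add_ne_top.2 ⟨?_, ?_⟩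
  · simpa [hpow] using hgeo
  · refine ne_top_of_le_ne_top hgeo (ENNReal.tsum_le_tsum fun m => ?_)
    rw [← hpow]
    refine ENNReal.rpow_le_rpow_of_exponent_le (by norm_num) ?_
    have : |((-((m : ℤ) + 1) : ℤ) : ℝ)| = m + 1 := by
      push_cast
      rw [abs_neg, abs_of_nonneg (by positivity)]
    rw [this]
    nlinarith

/-- Iteration of a one-step estimate along a path in `ℤ^n`. -/
lemma le_of_exists_step_le {b G : (Fin n → ℤ) → ℝ≥0∞} {r ρ B : ℝ≥0∞} (hr : r < 1) (hρ : ρ < 1)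
    (hB : B ≠ ∞) (hb : ∀ ν, b ν ≤ B)
    (hstep : ∀ ν, ∃ k, b ν ≤ G ν + r * b (ν + Pi.single k 1))
    (hG : ∀ ν k, r * G (ν + Pi.single k 1) ≤ ρ * G ν) (ν : Fin n → ℤ) :
    b ν ≤ (1 - ρ)⁻¹ * G ν := by
  have hρ0 : 1 - ρ ≠ 0 := (tsub_pos_of_lt hρ).ne'
  have hρt : 1 - ρ ≠ ∞ := ne_top_of_le_ne_top ENNReal.one_ne_top tsub_le_self
  have hgeo : 1 + (1 - ρ)⁻¹ * ρ = (1 - ρ)⁻¹ := by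
    calc 1 + (1 - ρ)⁻¹ * ρ = (1 - ρ)⁻¹ * ((1 - ρ) + ρ) := by
          rw [mul_add, ENNReal.inv_mul_cancel hρ0 hρt]
      _ = _ := by rw [tsub_add_cancel_of_le hρ.le, mul_one]
  -- After J steps the remainder is r^J times the uniform bound B, whichever directions were chosen;
  -- it vanishes as J → ∞.
  have key : ∀ (J : ℕ) (ν), b ν ≤ (1 - ρ)⁻¹ * G ν + r ^ J * B := by
    intro J
    induction J with
    | zero => intro ν; simpa using (hb ν).trans le_add_self
    | succ J ih =>
      intro ν
      obtain ⟨k, hk⟩ := hstep ν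
      calc b ν ≤ G ν + r * b (ν + Pi.single k 1) := hk
        _ ≤ G ν + r * ((1 - ρ)⁻¹ * G (ν + Pi.single k 1) + r ^ J * B) := by
            gcongr; exact ih _
        _ = G ν + (1 - ρ)⁻¹ * (r * G (ν + Pi.single k 1)) + r ^ (J + 1) * B := by ring
        _ ≤ G ν + (1 - ρ)⁻¹ * (ρ * G ν) + r ^ (J + 1) * B := by
            exact add_le_add (add_le_add le_rfl (mul_le_mul' le_rfl (hG ν k))) le_rfl
        _ = (1 + (1 - ρ)⁻¹ * ρ) * G ν + r ^ (J + 1) * B := by ring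
        _ = _ := by rw [hgeo]
  have hlim : Filter.Tendsto (fun J : ℕ => (1 - ρ)⁻¹ * G ν + r ^ J * B) Filter.atTop
      (nhds ((1 - ρ)⁻¹ * G ν + 0 * B)) :=
    tendsto_const_nhds.add
      (ENNReal.Tendsto.mul_const (ENNReal.tendsto_pow_atTop_nhds_zero_of_lt_one hr) (Or.inr hB))
  rw [zero_mul, add_zero] at hlim
  exact ge_of_tendsto' hlim fun J => key J ν

lemma rpow_sum_of_nonneg {ι : Type*} (s : Finset ι) (x : ℝ≥0∞) {lam : ι → ℝ}
    (hlam : ∀ i ∈ s, 0 ≤ lam i) : ∏ i ∈ s, x ^ lam i = x ^ ∑ i ∈ s, lam i := by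
  classical
  induction s using Finset.induction_on with
  | empty => simp
  | insert a s ha ih =>
    rw [Finset.prod_insert ha, Finset.sum_insert ha,
      ih fun i hi => hlam i (Finset.mem_insert_of_mem hi),
      ENNReal.rpow_add_of_nonneg _ _ (hlam a (Finset.mem_insert_self a s))
        (Finset.sum_nonneg fun i hi => hlam i (Finset.mem_insert_of_mem hi))]

lemma exists_le_geom_mean {ι : Type*} [Fintype ι] [Nonempty ι] (x : ι → ℝ≥0∞) {lam : ι → ℝ}
    (hlam : ∀ i, 0 ≤ lam i) (hsum : ∑ i, lam i = 1) : ∃ k, x k ≤ ∏ i, x i ^ lam i := by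
  obtain ⟨k, -, hk⟩ := Finset.exists_min_image Finset.univ x Finset.univ_nonempty
  refine ⟨k, ?_⟩
  calc x k = ∏ i, x k ^ lam i := by
        rw [rpow_sum_of_nonneg _ _ fun i _ => hlam i, hsum, ENNReal.rpow_one]
    _ ≤ _ := Finset.prod_le_prod' fun i _ => ENNReal.rpow_le_rpow (hk i (Finset.mem_univ i)) (hlam i)

/-- The `ℓ^θ` bound `‖A‖_{ℓ^θ} ≤ M`, `0 < θ ≤ ∞`. -/
def LpSumLe {ι : Type*} (θ : ℝ≥0∞) (A : ι → ℝ≥0∞) (M : ℝ≥0∞) : Prop :=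
  if θ = ∞ then ∀ i, A i ≤ M else ∑' i, A i ^ θ.toReal ≤ M ^ θ.toReal

/-- Hölder's inequality for products of finitely many sequences in `ℓ^{θ_k}`, `θ_k ≤ ∞`. -/
lemma tsum_prod_rpow_le {ι κ : Type*} [Countable ι] [Fintype κ] {A : κ → ι → ℝ≥0∞} {M : κ → ℝ≥0∞}
    {θ : κ → ℝ≥0∞} (hθ0 : ∀ k, θ k ≠ 0) (hA : ∀ k, LpSumLe (θ k) (A k) (M k)) {lam : κ → ℝ}
    (hlam : ∀ k, 0 ≤ lam k) {t : ℝ} (ht : 0 < t)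
    (hsum : ∑ k, lam k * (θ k).toReal⁻¹ = t⁻¹) :
    ∑' i, (∏ k, A k i ^ lam k) ^ t ≤ (∏ k, M k ^ lam k) ^ t := by
  classical
  let _ : MeasurableSpace ι := ⊤
  set f : κ → ι → ℝ≥0∞ := fun k i => if θ k = ∞ then 1 else A k i ^ (θ k).toReal with hf
  set W : κ → ℝ≥0∞ := fun k => if θ k = ∞ then (M k ^ lam k) ^ t else 1 with hW
  set e : κ → ℝ := fun k => lam k * (θ k).toReal⁻¹ * t with he
  have he0 : ∀ k, 0 ≤ e k := fun k => by
    have := hlam k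
    positivity
  have hesum : ∑ k, e k = 1 := by
    rw [he, ← Finset.sum_mul, hsum, inv_mul_cancel₀ ht.ne']
  have hfin : ∀ k, θ k ≠ ∞ → ∀ x : ℝ≥0∞, (x ^ (θ k).toReal) ^ e k = (x ^ lam k) ^ t := by
    intro k hk x
    rw [← ENNReal.rpow_mul, ← ENNReal.rpow_mul]
    congr 1
    have := ENNReal.toReal_pos (hθ0 k) hk
    simp only [he]
    field_simp
  have hpt : ∀ i, (∏ k, A k i ^ lam k) ^ t ≤ (∏ k, W k) * ∏ k, f k i ^ e k := by
    intro i
    rw [← ENNReal.prod_rpow_of_nonneg ht.le, ← Finset.prod_mul_distrib]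
    refine Finset.prod_le_prod' fun k _ => ?_
    by_cases hk : θ k = ∞
    · have h1 := hA k
      rw [LpSumLe, if_pos hk] at h1
      simp only [hW, hf, if_pos hk, ENNReal.one_rpow, mul_one]
      exact ENNReal.rpow_le_rpow (ENNReal.rpow_le_rpow (h1 i) (hlam k)) ht.le
    · simp only [hW, hf, if_neg hk, one_mul]
      rw [hfin k hk]
  calc _ ≤ ∑' i, (∏ k, W k) * ∏ k, f k i ^ e k := ENNReal.tsum_le_tsum hpt
    _ = (∏ k, W k) * ∫⁻ i, ∏ k, f k i ^ e k ∂Measure.count := by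
        rw [ENNReal.tsum_mul_left, lintegral_count]
    _ ≤ (∏ k, W k) * ∏ k, (∫⁻ i, f k i ∂Measure.count) ^ e k := by
        gcongr
        exact ENNReal.lintegral_prod_norm_pow_le _ (fun k _ => measurable_from_top.aemeasurable)
          hesum fun k _ => he0 k
    _ ≤ _ := by
        rw [← ENNReal.prod_rpow_of_nonneg ht.le, ← Finset.prod_mul_distrib]
        refine Finset.prod_le_prod' fun k _ => ?_
        rw [lintegral_count]
        by_cases hk : θ k = ∞
        · have : e k = 0 := by simp [he, hk]
          simp only [hW, if_pos hk, this, ENNReal.rpow_zero, mul_one, le_refl]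
        · have h1 := hA k
          rw [LpSumLe, if_neg hk] at h1
          simp only [hW, hf, if_neg hk, one_mul]
          rw [← hfin k hk]
          exact ENNReal.rpow_le_rpow h1 (he0 k)

/-- The constant would be K^{1/θ}; since K, θ ≥ 1 it is bounded by K, uniformly in θ and also for θ
= ∞. -/
lemma LpSumLe.slowMajorant {ε : ℝ} (hε : 0 ≤ ε) {z : (Fin n → ℤ) → ℝ≥0∞} {θ M K : ℝ≥0∞}
    (hθ : 1 ≤ θ) (hK : ∑' ξ : Fin n → ℤ, latticeWeight ε ξ ≤ K) (hK1 : 1 ≤ K)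
    (hz : LpSumLe θ z M) : LpSumLe θ (slowMajorant ε z) (K * M) := by
  unfold LpSumLe at hz ⊢
  split_ifs at hz ⊢ with h
  · intro ν
    refine (slowMajorant_le_of_le hε hz ν).trans ?_
    calc M = 1 * M := (one_mul M).symm
      _ ≤ K * M := by gcongr
  · have hθ1 : 1 ≤ θ.toReal := by
      rw [← ENNReal.toReal_one]; exact ENNReal.toReal_mono h hθ
    refine (tsum_slowMajorant_rpow_le hε z hθ1).trans ?_
    rw [ENNReal.mul_rpow_of_nonneg _ _ (by linarith)]
    exact mul_le_mul' (hK.trans (ENNReal.le_rpow_self_of_one_le hK1 hθ1)) hz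

end Lattice

/-! ### Dyadic boxes and box norms. -/

section Dyadic

variable {n : ℕ}

/-- The dyadic box `∏ [2^{ν_i}, 2^{ν_i + 1})`. -/
def dyadicBox (ν : Fin n → ℤ) : Set (Fin n → ℝ) :=
  Set.univ.pi fun i => Set.Ico ((2 : ℝ) ^ ν i) (2 ^ (ν i + 1))

lemma measurableSet_dyadicBox (ν : Fin n → ℤ) : MeasurableSet (dyadicBox ν) :=
  MeasurableSet.univ_pi fun _ => measurableSet_Ico

lemma volume_dyadicBox (ν : Fin n → ℤ) :
    volume (dyadicBox ν) = ENNReal.ofReal (∏ i, (2 : ℝ) ^ ν i) := by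
  rw [dyadicBox, volume_pi_pi, ENNReal.ofReal_prod_of_nonneg fun i _ => by positivity]
  refine Finset.prod_congr rfl fun i _ => ?_
  rw [Real.volume_Ico, zpow_add_one₀ (by norm_num)]
  congr 1
  ring

lemma pairwise_disjoint_dyadicBox :
    Pairwise (Function.onFun Disjoint (dyadicBox : (Fin n → ℤ) → Set (Fin n → ℝ))) := by
  intro ν μ hνμ
  refine Set.disjoint_left.2 fun x hx hy => hνμ ?_
  funext i
  have h1 := hx i (Set.mem_univ i)
  have h2 := hy i (Set.mem_univ i)
  have h3 := (zpow_lt_zpow_iff_right₀ (one_lt_two (α := ℝ))).1 (h1.1.trans_lt h2.2)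
  have h4 := (zpow_lt_zpow_iff_right₀ (one_lt_two (α := ℝ))).1 (h2.1.trans_lt h1.2)
  omega

lemma posOrthant_subset_iUnion_dyadicBox :
    posOrthant n ⊆ ⋃ ν : Fin n → ℤ, dyadicBox ν := by
  intro x hx
  have h : ∀ i, ∃ m : ℤ, x i ∈ Set.Ico ((2 : ℝ) ^ m) (2 ^ (m + 1)) := fun i =>
    exists_mem_Ico_zpow (hx i) one_lt_two
  choose ν hν using h
  exact Set.mem_iUnion.2 ⟨ν, fun i _ => hν i⟩

lemma tsum_setLIntegral_dyadicBox_le (H : (Fin n → ℝ) → ℝ≥0∞) :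
    ∑' ν : Fin n → ℤ, ∫⁻ x in dyadicBox ν, H x ≤ ∫⁻ x, H x := by
  rw [← lintegral_iUnion measurableSet_dyadicBox pairwise_disjoint_dyadicBox]
  exact setLIntegral_le_lintegral _ _

lemma coordMap_two_mem_dyadicBox_iff (k : Fin n) (ν : Fin n → ℤ) (x : Fin n → ℝ) :
    coordMap k (2 * ·) x ∈ dyadicBox (ν + Pi.single k 1) ↔ x ∈ dyadicBox ν := by
  simp only [dyadicBox, Set.mem_univ_pi]
  refine forall_congr' fun i => ?_
  rcases eq_or_ne i k with rfl | hi
  · simp only [coordMap, Function.update_self, Pi.add_apply, Pi.single_eq_same, Set.mem_Ico]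
    rw [zpow_add_one₀ (two_ne_zero (α := ℝ)) (ν i + 1), zpow_add_one₀ (two_ne_zero (α := ℝ)) (ν i)]
    constructor <;> rintro ⟨h1, h2⟩ <;> constructor <;> linarith
  · simp [coordMap, hi]

lemma lintegral_comp_two_mul (h : ℝ → ℝ≥0∞) (hh : Measurable h) :
    ∫⁻ s, h (2 * s) = 2⁻¹ * ∫⁻ s, h s := by
  rw [← lintegral_map hh (measurable_const_mul 2), Real.map_volume_mul_left two_ne_zero,
    lintegral_smul_measure]
  congr 1
  rw [abs_of_pos (by norm_num), ENNReal.ofReal_inv_of_pos (by norm_num)]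
  simp

lemma lintegral_comp_coordMap_two_le (k : Fin n) {H : (Fin n → ℝ) → ℝ≥0∞} (hH : Measurable H) :
    ∫⁻ x, H (coordMap k (2 * ·) x) ≤ 2⁻¹ * ∫⁻ x, H x := by
  rw [← lintegral_const_mul _ hH]
  refine lintegral_le_of_fibre_le k (hH.comp (measurable_coordMap k (by fun_prop)))
    (hH.const_mul _) fun x => ?_
  have hu : Measurable fun s : ℝ => H (Function.update x k s) := hH.comp (measurable_update x)
  simp only [coordMap_update]
  rw [lintegral_comp_two_mul _ hu, lintegral_const_mul _ hu]

/-- The `L^p` norm of `F` over a dyadic box. -/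
noncomputable def boxNorm (p : ℝ) (F : (Fin n → ℝ) → ℝ≥0∞) (ν : Fin n → ℤ) : ℝ≥0∞ :=
  (∫⁻ x in dyadicBox ν, F x ^ p) ^ (1 / p)

/-- The decrease of `F` under doubling of the `k`-th coordinate. -/
noncomputable def doublingGap (k : Fin n) (F : (Fin n → ℝ) → ℝ≥0∞) (x : Fin n → ℝ) : ℝ≥0∞ :=
  F x - F (coordMap k (2 * ·) x)

lemma measurable_doublingGap (k : Fin n) {F : (Fin n → ℝ) → ℝ≥0∞} (hF : Measurable F) :
    Measurable (doublingGap k F) :=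
  hF.sub (hF.comp (measurable_coordMap k (by fun_prop)))

lemma boxNorm_rpow {p : ℝ} (hp : 0 < p) (F : (Fin n → ℝ) → ℝ≥0∞) (ν : Fin n → ℤ) :
    boxNorm p F ν ^ p = ∫⁻ x in dyadicBox ν, F x ^ p := by
  rw [boxNorm, ← ENNReal.rpow_mul, one_div_mul_cancel hp.ne', ENNReal.rpow_one]

/-- Minkowski's inequality for F ≤ D_k + F(…, 2x_k, …). Doubling carries the box ν to the box ν +
e_k and the change of variables gives 2^{-1/p}. -/
lemma boxNorm_le_doublingGap_add {p : ℝ} (hp : 1 ≤ p) {F : (Fin n → ℝ) → ℝ≥0∞}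
    (hF : Measurable F) (k : Fin n) (ν : Fin n → ℤ) :
    boxNorm p F ν ≤ boxNorm p (doublingGap k F) ν +
      2 ^ (-(1 / p)) * boxNorm p F (ν + Pi.single k 1) := by
  have hp0 : 0 < p := by linarith
  have hT : Measurable (coordMap (n := n) k (2 * ·)) := measurable_coordMap k (by fun_prop)
  have hshift : (∫⁻ x in dyadicBox ν, F (coordMap k (2 * ·) x) ^ p) ^ (1 / p) ≤
      2 ^ (-(1 / p)) * boxNorm p F (ν + Pi.single k 1) := by
    have h1 : ∫⁻ x in dyadicBox ν, F (coordMap k (2 * ·) x) ^ p ≤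
        2⁻¹ * ∫⁻ x in dyadicBox (ν + Pi.single k 1), F x ^ p := by
      rw [← lintegral_indicator (measurableSet_dyadicBox ν),
        ← lintegral_indicator (measurableSet_dyadicBox _)]
      refine le_trans (le_of_eq (lintegral_congr fun x => ?_)) (lintegral_comp_coordMap_two_le k
        ((hF.pow_const p).indicator (measurableSet_dyadicBox (ν + Pi.single k 1))))
      by_cases hx : x ∈ dyadicBox ν
      · rw [Set.indicator_of_mem hx,
          Set.indicator_of_mem ((coordMap_two_mem_dyadicBox_iff k ν x).2 hx)]
      · rw [Set.indicator_of_notMem hx,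
          Set.indicator_of_notMem fun h => hx ((coordMap_two_mem_dyadicBox_iff k ν x).1 h)]
    refine (ENNReal.rpow_le_rpow h1 (by positivity)).trans_eq ?_
    rw [ENNReal.mul_rpow_of_nonneg _ _ (by positivity), boxNorm, ENNReal.inv_rpow,
      ENNReal.rpow_neg]
  refine le_trans ?_ (add_le_add le_rfl hshift)
  refine le_trans (ENNReal.rpow_le_rpow (lintegral_mono fun x => ENNReal.rpow_le_rpow
    (le_tsub_add (a := F (coordMap k (2 * ·) x))) hp0.le) (by positivity)) ?_
  exact ENNReal.lintegral_Lp_add_le (measurable_doublingGap k hF).aemeasurable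
    (hF.comp hT).aemeasurable hp

lemma boxNorm_le_lintegral {p : ℝ} (hp : 0 < p) (F : (Fin n → ℝ) → ℝ≥0∞) (ν : Fin n → ℤ) :
    boxNorm p F ν ≤ (∫⁻ x, F x ^ p) ^ (1 / p) :=
  ENNReal.rpow_le_rpow (setLIntegral_le_lintegral _ _) (by positivity)

/-- The part of the box norms living on scales larger than `δ` in the `k`-th coordinate. -/
noncomputable def tailBoxNorm (p δ : ℝ) (k : Fin n) (D : (Fin n → ℝ) → ℝ≥0∞) (ν : Fin n → ℤ) :
    ℝ≥0∞ :=
  (Set.Iic ((2 : ℝ) ^ ν k)).indicator (fun δ => ENNReal.ofReal (δ * 2 ^ (-(ν k : ℝ) - 1))) δ *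
    boxNorm p D ν

/-- On the box ν one has δ/x_k ≥ δ 2^{-ν_k-1}, so the p-th powers sum to at most the weighted
integral over disjoint boxes. The passage from ℓ^p to ℓ^θ is where p ≤ θ enters. -/
lemma tsum_tailBoxNorm_rpow_le {p θ δ : ℝ} (hp : 0 < p) (hθ : p ≤ θ) (hδ : 0 < δ) (k : Fin n)
    {D : (Fin n → ℝ) → ℝ≥0∞} (hD : Measurable D) {ω : ℝ≥0∞}
    (h : ∫⁻ x, (tailWeight δ (x k) * D x) ^ p ≤ ω ^ p) :
    ∑' ν, tailBoxNorm p δ k D ν ^ θ ≤ ω ^ θ := by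
  have hterm : ∀ ν, tailBoxNorm p δ k D ν ^ p ≤
      ∫⁻ x in dyadicBox ν, (tailWeight δ (x k) * D x) ^ p := by
    intro ν
    by_cases hν : δ ≤ (2 : ℝ) ^ ν k
    · rw [tailBoxNorm, Set.indicator_of_mem (show δ ∈ Set.Iic ((2 : ℝ) ^ ν k) from hν),
        ENNReal.mul_rpow_of_nonneg _ _ hp.le, boxNorm_rpow hp,
        ← lintegral_const_mul _ (hD.pow_const p)]
      refine setLIntegral_mono' (measurableSet_dyadicBox ν) fun x hx => ?_
      rw [← ENNReal.mul_rpow_of_nonneg _ _ hp.le]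
      have hxk := hx k (Set.mem_univ k)
      have hx0 : 0 < x k := hδ.trans_le (hν.trans hxk.1)
      refine ENNReal.rpow_le_rpow (mul_le_mul' ?_ le_rfl) hp.le
      rw [tailWeight, Set.indicator_of_mem (show x k ∈ Set.Ici δ from hν.trans hxk.1)]
      refine ENNReal.ofReal_le_ofReal ?_
      rw [div_eq_mul_inv]
      refine mul_le_mul_of_nonneg_left ?_ hδ.le
      have e : (2 : ℝ) ^ (-(ν k : ℝ) - 1) = ((2 : ℝ) ^ (ν k + 1))⁻¹ := by
        rw [← Real.rpow_intCast, ← Real.rpow_neg (by norm_num)]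
        push_cast
        ring_nf
      rw [e]
      exact inv_anti₀ hx0 hxk.2.le
    · rw [tailBoxNorm, Set.indicator_of_notMem (show δ ∉ Set.Iic ((2 : ℝ) ^ ν k) from hν),
        zero_mul, ENNReal.zero_rpow_of_pos hp]
      exact bot_le
  have hsum : ∑' ν, tailBoxNorm p δ k D ν ^ p ≤ ω ^ p :=
    (ENNReal.tsum_le_tsum hterm).trans ((tsum_setLIntegral_dyadicBox_le _).trans h)
  have e : ∀ y : ℝ≥0∞, y ^ θ = (y ^ p) ^ (θ / p) := fun y => by
    rw [← ENNReal.rpow_mul, mul_div_cancel₀ _ hp.ne']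
  simp_rw [e]
  exact (tsum_rpow_le_rpow_tsum _ ((one_le_div hp).2 hθ)).trans
    (ENNReal.rpow_le_rpow hsum (div_nonneg (hp.le.trans hθ) hp.le))

lemma lintegral_rpow_sub_one_Ioc {A s : ℝ} (hA : 0 < A) (hs : 0 < s) :
    ∫⁻ t in Set.Ioc 0 A, ENNReal.ofReal (t ^ (s - 1)) = ENNReal.ofReal (A ^ s / s) := by
  have hint : IntervalIntegrable (fun t : ℝ => t ^ (s - 1)) volume 0 A :=
    intervalIntegral.intervalIntegrable_rpow' (by linarith)
  have hval : ∫ t in (0 : ℝ)..A, t ^ (s - 1) = A ^ s / s := by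
    rw [integral_rpow (Or.inl (by linarith)), sub_add_cancel, Real.zero_rpow hs.ne', sub_zero]
  rw [← hval, intervalIntegral.integral_of_le hA.le, ofReal_integral_eq_lintegral_ofReal
    ((intervalIntegrable_iff_integrableOn_Ioc_of_le hA.le).1 hint)]
  exact (ae_restrict_iff' measurableSet_Ioc).2
    (Filter.Eventually.of_forall fun t ht => Real.rpow_nonneg ht.1.le _)

/-- For δ ≤ 2^{ν_k} the tail norm is linear in δ, so the integrand is a multiple of δ^{(1-α)θ-1}.
Integrating up to 2^{ν_k} yields 1/((1-α)θ), the source of the factor (1-β_k)^{1/θ_k}. -/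
lemma le_lintegral_tailBoxNorm {p α θ : ℝ} (hα : α < 1) (hθ : 0 < θ) (k : Fin n)
    (D : (Fin n → ℝ) → ℝ≥0∞) (ν : Fin n → ℤ) :
    ENNReal.ofReal (((1 - α) * θ * 2 ^ θ)⁻¹) * (2 ^ (-(α * ν k)) * boxNorm p D ν) ^ θ ≤
      ∫⁻ δ in Set.Ioi (0 : ℝ),
        (ENNReal.ofReal (δ ^ (-α)) * tailBoxNorm p δ k D ν) ^ θ / ENNReal.ofReal δ := by
  have hs : 0 < (1 - α) * θ := mul_pos (by linarith) hθ
  have hA : (0 : ℝ) < 2 ^ ν k := by positivity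
  have h2 : (0 : ℝ) < 2 ^ (-(ν k : ℝ) - 1) := Real.rpow_pos_of_pos two_pos _
  have hpt : ∀ δ ∈ Set.Ioc (0 : ℝ) (2 ^ ν k),
      (ENNReal.ofReal (δ ^ (-α)) * tailBoxNorm p δ k D ν) ^ θ / ENNReal.ofReal δ =
        boxNorm p D ν ^ θ * ENNReal.ofReal ((2 ^ (-(ν k : ℝ) - 1)) ^ θ) *
          ENNReal.ofReal (δ ^ ((1 - α) * θ - 1)) := by
    intro δ hδ
    rw [tailBoxNorm, Set.indicator_of_mem (show δ ∈ Set.Iic ((2 : ℝ) ^ ν k) from hδ.2), ← mul_assoc,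
      ← ENNReal.ofReal_mul (Real.rpow_nonneg hδ.1.le _), ENNReal.mul_rpow_of_nonneg _ _ hθ.le,
      ENNReal.ofReal_rpow_of_nonneg
        (mul_nonneg (Real.rpow_nonneg hδ.1.le _) (mul_nonneg hδ.1.le h2.le)) hθ.le,
      mul_comm (ENNReal.ofReal _), mul_div_assoc, ← ENNReal.ofReal_div_of_pos hδ.1, mul_assoc,
      ← ENNReal.ofReal_mul (Real.rpow_nonneg h2.le _)]
    congr 2
    have e1 : δ ^ (-α) * (δ * 2 ^ (-(ν k : ℝ) - 1)) = 2 ^ (-(ν k : ℝ) - 1) * δ ^ (1 - α) := by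
      have : δ ^ (1 - α) = δ ^ (-α) * δ := by
        rw [← Real.rpow_add_one hδ.1.ne']; ring_nf
      rw [this]; ring
    rw [e1, Real.mul_rpow h2.le (Real.rpow_nonneg hδ.1.le _), ← Real.rpow_mul hδ.1.le,
      Real.rpow_sub_one hδ.1.ne']
    ring
  calc _ = boxNorm p D ν ^ θ * ENNReal.ofReal ((2 ^ (-(ν k : ℝ) - 1)) ^ θ) *
        ENNReal.ofReal ((2 ^ ν k : ℝ) ^ ((1 - α) * θ) / ((1 - α) * θ)) := by
        rw [ENNReal.mul_rpow_of_nonneg _ _ hθ.le, mul_comm (((2 : ℝ≥0∞) ^ _) ^ θ),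
          mul_left_comm, mul_assoc (boxNorm p D ν ^ θ)]
        congr 1
        have e2 : (2 : ℝ≥0∞) ^ (-(α * ν k)) = ENNReal.ofReal (2 ^ (-(α * ν k))) := by
          rw [← ENNReal.ofReal_rpow_of_pos two_pos]; simp
        rw [e2, ENNReal.ofReal_rpow_of_pos (Real.rpow_pos_of_pos two_pos _),
          ← ENNReal.ofReal_mul (by positivity), ← ENNReal.ofReal_mul (by positivity)]
        congr 1
        rw [← Real.rpow_mul two_pos.le, ← Real.rpow_mul two_pos.le, ← Real.rpow_intCast,
          ← Real.rpow_mul two_pos.le, mul_inv, ← Real.rpow_neg two_pos.le, div_eq_mul_inv,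
          ← mul_assoc ((2 : ℝ) ^ _), ← Real.rpow_add two_pos, mul_assoc, ← Real.rpow_add two_pos,
          mul_comm]
        congr 2
        ring
    _ = ∫⁻ δ in Set.Ioc (0 : ℝ) (2 ^ ν k),
        (ENNReal.ofReal (δ ^ (-α)) * tailBoxNorm p δ k D ν) ^ θ / ENNReal.ofReal δ := by
        rw [setLIntegral_congr_fun measurableSet_Ioc hpt, lintegral_const_mul _ (by fun_prop),
          lintegral_rpow_sub_one_Ioc hA hs]
    _ ≤ _ := lintegral_mono_set fun δ hδ => hδ.1

end Dyadic

/-! ### Box norms of doubling differences versus Besov seminorms. -/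

section Embedding

variable {n : ℕ}

lemma partialModulus_congr_ae {f g : (Fin n → ℝ) → ℝ} (h : f =ᵐ[volume] g) (p : ℝ) (k : Fin n)
    (δ : ℝ) : partialModulus p k f δ = partialModulus p k g δ := by
  unfold partialModulus
  refine iSup_congr fun u => iSup_congr fun _ => eLpNorm_congr_ae ?_
  have h' := (measurePreserving_add_right (volume : Measure (Fin n → ℝ))
    (Pi.single k u)).quasiMeasurePreserving.ae_eq_comp h
  filter_upwards [h, h'] with x h1 h2
  simp only [Function.comp_apply] at h2
  rw [h1, h2]

lemma besovSeminorm_congr_ae {f g : (Fin n → ℝ) → ℝ} (h : f =ᵐ[volume] g) (α p : ℝ) (θ : ℝ≥0∞)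
    (k : Fin n) : besovSeminorm α p θ k f = besovSeminorm α p θ k g := by
  simp only [besovSeminorm, partialModulus_congr_ae h]

lemma modLorentzNorm_congr_ae {f g : (Fin n → ℝ) → ℝ} (h : f =ᵐ[volume] g) (q : ℝ) (r : ℝ≥0∞)
    (σ : Equiv.Perm (Fin n)) : modLorentzNorm q r σ f = modLorentzNorm q r σ g := by
  have h' := ae_restrict_of_ae (s := posOrthant n) (iteratedRearrangement_congr_ae h σ)
  unfold modLorentzNorm
  congr 1
  · refine essSup_congr_ae ?_
    filter_upwards [h'] with t ht
    rw [ht]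
  · congr 1
    refine lintegral_congr_ae ?_
    filter_upwards [h'] with t ht
    rw [ht]

lemma lintegral_tailWeight_doublingGap_le {f : (Fin n → ℝ) → ℝ} (hf : Measurable f)
    (σ : Equiv.Perm (Fin n)) (k : Fin n) {δ : ℝ} (hδ : 0 < δ) {p : ℝ} (hp : 1 ≤ p) :
    ∫⁻ x, (tailWeight δ (x k) * doublingGap k (iteratedRearrangement σ f) x) ^ p ≤
      (48 * partialModulus p k f δ) ^ p := by
  have hp0 : 0 < p := by linarith
  refine (lintegral_tailWeight_iteratedRearrangement_le hf σ k hδ hp).trans ?_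
  rw [ENNReal.mul_rpow_of_nonneg _ _ hp0.le]
  gcongr
  calc (4 : ℝ≥0∞) * 12 ^ p ≤ 4 ^ p * 12 ^ p := by
        gcongr
        exact ENNReal.le_rpow_self_of_one_le (by norm_num) hp
    _ = 48 ^ p := by
        rw [← ENNReal.mul_rpow_of_nonneg _ _ hp0.le]; norm_num

/-- Only the scale δ = 2^{ν_k} is used, where the tail weight on the box is 1/2; this serves the
case θ_k = ∞. -/
lemma boxNorm_doublingGap_le {f : (Fin n → ℝ) → ℝ} (hf : Measurable f)
    (σ : Equiv.Perm (Fin n)) (k : Fin n) {p : ℝ} (hp : 1 ≤ p) (ν : Fin n → ℤ) :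
    boxNorm p (doublingGap k (iteratedRearrangement σ f)) ν ≤
      96 * partialModulus p k f (2 ^ ν k) := by
  have hp0 : 0 < p := by linarith
  have hδ : (0 : ℝ) < 2 ^ ν k := by positivity
  have h1 := tsum_tailBoxNorm_rpow_le hp0 le_rfl hδ k
    (measurable_doublingGap k (measurable_iteratedRearrangement hf σ))
    (lintegral_tailWeight_doublingGap_le hf σ k hδ hp)
  have h2 := (ENNReal.rpow_le_rpow_iff hp0).1 ((ENNReal.le_tsum ν).trans h1)
  rw [tailBoxNorm, Set.indicator_of_mem (Set.mem_Iic.2 le_rfl)] at h2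
  have e : (2 : ℝ) ^ ν k * 2 ^ (-(ν k : ℝ) - 1) = 2⁻¹ := by
    rw [← Real.rpow_intCast, ← Real.rpow_add two_pos,
      show (ν k : ℝ) + (-(ν k : ℝ) - 1) = -1 by ring, Real.rpow_neg_one]
  rw [e, ENNReal.ofReal_inv_of_pos two_pos, ENNReal.ofReal_ofNat] at h2
  calc boxNorm p (doublingGap k (iteratedRearrangement σ f)) ν
      = 2 * (2⁻¹ * boxNorm p (doublingGap k (iteratedRearrangement σ f)) ν) := by
        rw [← mul_assoc, ENNReal.mul_inv_cancel (by norm_num) (by norm_num), one_mul]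
    _ ≤ 2 * (48 * partialModulus p k f (2 ^ ν k)) := by gcongr
    _ = _ := by rw [← mul_assoc]; norm_num

/-- For each fixed δ a single modulus ω_k(f;δ)_p controls all boxes with 2^{ν_k} ≥ δ together, so
summing over ν inside the δ-integral loses nothing beyond the constant 48. -/
lemma tsum_boxNorm_doublingGap_le {f : (Fin n → ℝ) → ℝ} (hf : Measurable f)
    (σ : Equiv.Perm (Fin n)) (k : Fin n) {p θ α : ℝ} (hp : 1 ≤ p) (hθ : p ≤ θ) (hα : α < 1) :
    ∑' ν : Fin n → ℤ, (2 ^ (-(α * ν k)) *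
        boxNorm p (doublingGap k (iteratedRearrangement σ f)) ν) ^ θ ≤
      ENNReal.ofReal ((1 - α) * θ * 2 ^ θ) * (48 ^ θ * ∫⁻ t in Set.Ioi (0 : ℝ),
        (ENNReal.ofReal (t ^ (-α)) * partialModulus p k f t) ^ θ / ENNReal.ofReal t) := by
  have hp0 : 0 < p := by linarith
  have hθ0 : 0 < θ := hp0.trans_le hθ
  have hc : 0 < (1 - α) * θ * 2 ^ θ := by
    have : 0 < 1 - α := by linarith
    positivity
  set D := doublingGap k (iteratedRearrangement σ f) with hDdef
  have hD : Measurable D := measurable_doublingGap k (measurable_iteratedRearrangement hf σ)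
  have hmeas : ∀ ν : Fin n → ℤ, Measurable fun δ : ℝ =>
      (ENNReal.ofReal (δ ^ (-α)) * tailBoxNorm p δ k D ν) ^ θ / ENNReal.ofReal δ := by
    intro ν
    have h1 : Measurable fun δ : ℝ => tailBoxNorm p δ k D ν :=
      (Measurable.indicator (by fun_prop) measurableSet_Iic).mul_const _
    fun_prop
  have key : ENNReal.ofReal (((1 - α) * θ * 2 ^ θ)⁻¹) *
      ∑' ν : Fin n → ℤ, (2 ^ (-(α * ν k)) * boxNorm p D ν) ^ θ ≤
      48 ^ θ * ∫⁻ t in Set.Ioi (0 : ℝ),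
        (ENNReal.ofReal (t ^ (-α)) * partialModulus p k f t) ^ θ / ENNReal.ofReal t := by
    rw [← ENNReal.tsum_mul_left]
    calc _ ≤ ∑' ν, ∫⁻ δ in Set.Ioi (0 : ℝ),
          (ENNReal.ofReal (δ ^ (-α)) * tailBoxNorm p δ k D ν) ^ θ / ENNReal.ofReal δ :=
          ENNReal.tsum_le_tsum fun ν => le_lintegral_tailBoxNorm hα hθ0 k D ν
      _ = ∫⁻ δ in Set.Ioi (0 : ℝ), ∑' ν,
          (ENNReal.ofReal (δ ^ (-α)) * tailBoxNorm p δ k D ν) ^ θ / ENNReal.ofReal δ :=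
          (lintegral_tsum fun ν => (hmeas ν).aemeasurable).symm
      _ ≤ ∫⁻ δ in Set.Ioi (0 : ℝ), 48 ^ θ *
          ((ENNReal.ofReal (δ ^ (-α)) * partialModulus p k f δ) ^ θ / ENNReal.ofReal δ) := by
          refine setLIntegral_mono' measurableSet_Ioi fun δ hδ => ?_
          have h1 := tsum_tailBoxNorm_rpow_le hp0 hθ hδ k hD
            (lintegral_tailWeight_doublingGap_le hf σ k hδ hp)
          simp_rw [ENNReal.mul_rpow_of_nonneg _ _ hθ0.le, div_eq_mul_inv]
          rw [ENNReal.tsum_mul_right, ENNReal.tsum_mul_left]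
          rw [ENNReal.mul_rpow_of_nonneg _ _ hθ0.le] at h1
          calc _ ≤ ENNReal.ofReal (δ ^ (-α)) ^ θ * (48 ^ θ * partialModulus p k f δ ^ θ) *
                (ENNReal.ofReal δ)⁻¹ := by gcongr
            _ = _ := by ring
      _ = _ := lintegral_const_mul' _ _
          (ENNReal.rpow_ne_top_of_nonneg hθ0.le (by norm_num))
  calc _ = ENNReal.ofReal ((1 - α) * θ * 2 ^ θ) * (ENNReal.ofReal (((1 - α) * θ * 2 ^ θ)⁻¹) *
        ∑' ν : Fin n → ℤ, (2 ^ (-(α * ν k)) * boxNorm p D ν) ^ θ) := by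
        rw [← mul_assoc, ← ENNReal.ofReal_mul hc.le, mul_inv_cancel₀ hc.ne', ENNReal.ofReal_one,
          one_mul]
    _ ≤ _ := by gcongr

/-- The weighted box norms of the dyadic differences of the iterated rearrangement are bounded in
`ℓ^θ` by the partial Besov seminorm, with the sharp dependence on `1 - α`. -/
lemma lpSumLe_boxNorm_doublingGap {f : (Fin n → ℝ) → ℝ} (hf : Measurable f)
    (σ : Equiv.Perm (Fin n)) (k : Fin n) {p α : ℝ} {θ : ℝ≥0∞} (hp : 1 ≤ p)
    (hθ : ENNReal.ofReal p ≤ θ) (hα : α < 1) :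
    LpSumLe θ (fun ν : Fin n → ℤ => 2 ^ (-(α * ν k)) *
        boxNorm p (doublingGap k (iteratedRearrangement σ f)) ν)
      (192 * (ENNReal.ofReal ((1 - α) ^ (1 / θ).toReal) * besovSeminorm α p θ k f)) := by
  have hp0 : 0 < p := by linarith
  unfold LpSumLe besovSeminorm
  split_ifs with h
  · intro ν
    have hδ : (0 : ℝ) < 2 ^ ν k := by positivity
    have hw : (2 : ℝ≥0∞) ^ (-(α * ν k)) = (ENNReal.ofReal (((2 : ℝ) ^ ν k) ^ α))⁻¹ := by
      rw [← Real.rpow_intCast, ← Real.rpow_mul two_pos.le, ← ENNReal.ofReal_rpow_of_pos two_pos,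
        ENNReal.ofReal_ofNat, ← ENNReal.rpow_neg, mul_comm]
    simp only [h, ENNReal.div_top, ENNReal.toReal_zero, Real.rpow_zero, ENNReal.ofReal_one, one_mul]
    calc _ ≤ (ENNReal.ofReal (((2 : ℝ) ^ ν k) ^ α))⁻¹ *
          (96 * partialModulus p k f (2 ^ ν k)) := by
          rw [hw]
          gcongr
          exact boxNorm_doublingGap_le hf σ k hp ν
      _ = 96 * (partialModulus p k f (2 ^ ν k) / ENNReal.ofReal (((2 : ℝ) ^ ν k) ^ α)) := by
          rw [div_eq_mul_inv]; ring
      _ ≤ _ := by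
          refine mul_le_mul' (by norm_num) ?_
          exact le_iSup₂_of_le (f := fun (δ : ℝ) (_ : 0 < δ) =>
            partialModulus p k f δ / ENNReal.ofReal (δ ^ α)) (2 ^ ν k) hδ le_rfl
  · have hθp : p ≤ θ.toReal := (ENNReal.ofReal_le_iff_le_toReal h).1 hθ
    set t := θ.toReal with ht
    have ht0 : 0 < t := hp0.trans_le hθp
    have hα1 : 0 < 1 - α := by linarith
    refine (tsum_boxNorm_doublingGap_le hf σ k hp hθp hα).trans ?_
    rw [ENNReal.mul_rpow_of_nonneg _ _ ht0.le, ENNReal.mul_rpow_of_nonneg _ _ ht0.le,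
      ← ENNReal.rpow_mul, one_div_mul_cancel ht0.ne', ENNReal.rpow_one,
      ENNReal.ofReal_rpow_of_nonneg (Real.rpow_nonneg hα1.le _) ht0.le, ← Real.rpow_mul hα1.le]
    have e1 : (1 / θ).toReal * t = 1 := by
      rw [one_div, ENNReal.toReal_inv, inv_mul_cancel₀ ht0.ne']
    rw [e1, Real.rpow_one, ← mul_assoc, ← mul_assoc]
    refine mul_le_mul' ?_ le_rfl
    -- Bernoulli's inequality gives θ ≤ 2^θ, so θ · 2^θ · 48^θ ≤ 192^θ and only the factor 1 - α
    -- remains outside the θ-th power.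
    have h2t : ENNReal.ofReal t ≤ 2 ^ t := by
      rw [show (2 : ℝ≥0∞) = ENNReal.ofReal 2 by simp, ENNReal.ofReal_rpow_of_pos two_pos]
      refine ENNReal.ofReal_le_ofReal ?_
      have := one_add_mul_self_le_rpow_one_add (s := 1) (by norm_num) (hp.trans hθp)
      norm_num at this
      linarith
    calc ENNReal.ofReal ((1 - α) * t * 2 ^ t) * 48 ^ t
        = ENNReal.ofReal (1 - α) * (ENNReal.ofReal t * 2 ^ t * 48 ^ t) := by
          rw [ENNReal.ofReal_mul (by positivity), ENNReal.ofReal_mul hα1.le,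
            ← ENNReal.ofReal_rpow_of_pos two_pos, ENNReal.ofReal_ofNat]
          ring
      _ ≤ ENNReal.ofReal (1 - α) * (2 ^ t * 2 ^ t * 48 ^ t) := by gcongr
      _ = 192 ^ t * ENNReal.ofReal (1 - α) := by
          rw [← ENNReal.mul_rpow_of_nonneg _ _ ht0.le, ← ENNReal.mul_rpow_of_nonneg _ _ ht0.le,
            mul_comm]
          norm_num

/-- Every point of the box ν lies coordinatewise below every point of the box ν + (1, …, 1), so F(t)
is a lower bound for F on the box ν, which has volume 2^{∑ ν_i}. -/
lemma iteratedRearrangement_mul_le_boxNorm (σ : Equiv.Perm (Fin n)) (f : (Fin n → ℝ) → ℝ) {p : ℝ}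
    (hp : 0 < p) {ν : Fin n → ℤ} {t : Fin n → ℝ} (ht : t ∈ dyadicBox (ν + 1)) :
    2 ^ ((∑ i, (ν i : ℝ)) / p) * iteratedRearrangement σ f t ≤
      boxNorm p (iteratedRearrangement σ f) ν := by
  have hvol : volume (dyadicBox ν) = 2 ^ (∑ i, (ν i : ℝ)) := by
    rw [volume_dyadicBox]
    have : (∏ i, (2 : ℝ) ^ ν i) = 2 ^ (∑ i, (ν i : ℝ)) := by
      rw [Real.rpow_sum_of_pos two_pos]
      simp_rw [Real.rpow_intCast]
    rw [this, ← ENNReal.ofReal_rpow_of_pos two_pos, ENNReal.ofReal_ofNat]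
  rw [← ENNReal.rpow_le_rpow_iff hp, boxNorm_rpow hp, ENNReal.mul_rpow_of_nonneg _ _ hp.le,
    ← ENNReal.rpow_mul, div_mul_cancel₀ _ hp.ne', ← hvol, mul_comm, ← setLIntegral_const]
  refine setLIntegral_mono' (measurableSet_dyadicBox ν) fun s hs => ?_
  refine ENNReal.rpow_le_rpow (iteratedRearrangement_antitone σ f (fun i => ?_) fun i => ?_) hp.le
  · exact lt_of_lt_of_le (by positivity) (hs i (Set.mem_univ i)).1
  · exact (hs i (Set.mem_univ i)).2.le.trans (ht i (Set.mem_univ i)).1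

end Embedding

/-! ### The mean summability exponent. -/

section Exponents

variable {n : ℕ}

/-- This is the Hölder relation 1/θ = ∑ λ_j/θ_j, kept in the extended reals so that infinite
exponents need no separate treatment. -/
lemma inv_meanExponent_eq {β : Fin n → ℝ} {θ : Fin n → ℝ≥0∞} {b : ℝ} {θm : ℝ≥0∞}
    (hβ : ∀ j, 0 < β j) (hb : 0 < b)
    (hθm : θm = ENNReal.ofReal (n / b) * (∑ j, 1 / (ENNReal.ofReal (β j) * θ j))⁻¹) (hn : 0 < n) :
    θm⁻¹ = ∑ j, ENNReal.ofReal (b / (n * β j)) * (θ j)⁻¹ := by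
  have hn' : (0 : ℝ) < n := by exact_mod_cast hn
  have hpos : 0 < (n : ℝ) / b := div_pos hn' hb
  rw [hθm, ENNReal.mul_inv (Or.inl (ENNReal.ofReal_pos.2 hpos).ne')
    (Or.inl ENNReal.ofReal_ne_top), inv_inv, Finset.mul_sum]
  refine Finset.sum_congr rfl fun j _ => ?_
  rw [one_div, ENNReal.mul_inv (Or.inl (ENNReal.ofReal_pos.2 (hβ j)).ne')
    (Or.inl ENNReal.ofReal_ne_top), ← mul_assoc, ← ENNReal.ofReal_inv_of_pos hpos,
    ← ENNReal.ofReal_inv_of_pos (hβ j), ← ENNReal.ofReal_mul (by positivity)]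
  congr 2
  have := hβ j
  field_simp

end Exponents

/-! ### Pointwise bound, summation and the final estimate. -/

section Embedding

variable {n : ℕ}

/-- A pointwise bound of the iterated rearrangement on dyadic boxes by slowly varying majorants of
the weighted box norms of its dyadic differences. -/
lemma iteratedRearrangement_le_prod_slowMajorant {f : (Fin n → ℝ) → ℝ} (hf : Measurable f)
    (hn : 0 < n) (σ : Equiv.Perm (Fin n)) {p q b ε : ℝ} {β : Fin n → ℝ} (hp : 1 ≤ p)
    (hfp : ∫⁻ x, ‖f x‖ₑ ^ p ≠ ∞) (hβ : ∀ j, 0 < β j) (hb : 0 < b)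
    (hlam : ∑ j, b / (n * β j) = 1) (hq : 1 / q = 1 / p - b / n) (hε : 0 < ε)
    (hqε : 2 * ε ≤ 1 / q) {ν : Fin n → ℤ} {t : Fin n → ℝ} (ht : t ∈ dyadicBox (ν + 1)) :
    ENNReal.ofReal ((∏ i, t i) ^ (1 / q)) * iteratedRearrangement σ f t ≤
      4 ^ n * (1 - 2 ^ (-ε))⁻¹ * ∏ k, slowMajorant ε (fun ν : Fin n → ℤ => 2 ^ (-(β k * ν k)) *
        boxNorm p (doublingGap k (iteratedRearrangement σ f)) ν) ν ^ (b / (n * β k)) := by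
  have hp0 : 0 < p := by linarith
  have hn' : (0 : ℝ) < n := by exact_mod_cast hn
  have : Nonempty (Fin n) := ⟨⟨0, hn⟩⟩
  have h20 : (2 : ℝ≥0∞) ≠ 0 := by norm_num
  have h2t : (2 : ℝ≥0∞) ≠ ∞ := by norm_num
  have hlam0 : ∀ k, 0 ≤ b / (n * β k) := fun k => by have := hβ k; positivity
  set F := iteratedRearrangement σ f with hFdef
  have hF : Measurable F := measurable_iteratedRearrangement hf σ
  set Z : Fin n → (Fin n → ℤ) → ℝ≥0∞ := fun k => slowMajorant ε (fun ν : Fin n → ℤ =>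
    2 ^ (-(β k * ν k)) * boxNorm p (doublingGap k F) ν) with hZ
  -- The weights 2^{β_k ν_k} combine in the geometric mean to 2^{(β/n) ∑ ν_i}, since β_k λ_k = β/n
  -- for every k.
  set G : (Fin n → ℤ) → ℝ≥0∞ := fun ν =>
    ∏ k, (2 ^ (β k * ν k) * Z k ν) ^ (b / (n * β k)) with hGdef
  have hρ : (2 : ℝ≥0∞) ^ (-ε) < 1 :=
    ENNReal.rpow_lt_one_of_one_lt_of_neg (by norm_num) (by linarith)
  have hr : (2 : ℝ≥0∞) ^ (-(1 / p)) < 1 :=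
    ENNReal.rpow_lt_one_of_one_lt_of_neg (by norm_num) (by
      have : 0 < 1 / p := by positivity
      linarith)
  -- A unit step in any direction multiplies G by at most 2^{ε + β/n}. Together with 2^{-1/p} this
  -- is 2^{ε - 1/q} ≤ 2^{-ε}, by 2ε ≤ 1/q.
  have hGstep : ∀ ν k, (2 : ℝ≥0∞) ^ (-(1 / p)) * G (ν + Pi.single k 1) ≤ 2 ^ (-ε) * G ν := by
    intro ν k
    have h1 : ∀ j, (2 ^ (β j * ((ν + Pi.single k 1 : Fin n → ℤ) j : ℝ)) *
        Z j (ν + Pi.single k 1)) ^ (b / (n * β j)) ≤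
        (2 ^ ε) ^ (b / (n * β j)) * (2 ^ (if j = k then b / n else 0)) *
          (2 ^ (β j * ν j) * Z j ν) ^ (b / (n * β j)) := by
      intro j
      have hexp : (2 : ℝ≥0∞) ^ (β j * ((ν + Pi.single k 1 : Fin n → ℤ) j : ℝ)) =
          2 ^ (if j = k then β j else 0) * 2 ^ (β j * ν j) := by
        rw [← ENNReal.rpow_add _ _ h20 h2t]
        congr 1
        split_ifs with hjk
        · subst hjk; simp; ring
        · simp [hjk]
      have hpow : ((2 : ℝ≥0∞) ^ (if j = k then β j else 0)) ^ (b / (n * β j)) =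
          2 ^ (if j = k then b / n else 0) := by
        rw [← ENNReal.rpow_mul]
        congr 1
        split_ifs
        · have := (hβ j).ne'
          field_simp
        · simp
      calc _ ≤ (2 ^ ε * (2 ^ (if j = k then β j else 0)) *
            (2 ^ (β j * ν j) * Z j ν)) ^ (b / (n * β j)) := by
            refine ENNReal.rpow_le_rpow ?_ (hlam0 j)
            rw [hexp]
            calc _ ≤ 2 ^ (if j = k then β j else 0) * 2 ^ (β j * ν j) * (2 ^ ε * Z j ν) :=
                  mul_le_mul' le_rfl (slowMajorant_add_single_le hε.le _ ν k)
              _ = _ := by ring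
        _ = _ := by
            rw [ENNReal.mul_rpow_of_nonneg _ _ (hlam0 j), ENNReal.mul_rpow_of_nonneg _ _ (hlam0 j),
              hpow]
    have h2 : G (ν + Pi.single k 1) ≤ 2 ^ ε * 2 ^ (b / n) * G ν := by
      refine (Finset.prod_le_prod' fun j _ => h1 j).trans_eq ?_
      rw [Finset.prod_mul_distrib, Finset.prod_mul_distrib,
        rpow_sum_of_nonneg _ _ fun j _ => hlam0 j, hlam, ENNReal.rpow_one]
      congr 2
      rw [Finset.prod_eq_single k]
      · simp
      · intro j _ hjk; simp [hjk]
      · simp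
    calc _ ≤ 2 ^ (-(1 / p)) * (2 ^ ε * 2 ^ (b / n) * G ν) := by gcongr
      _ = 2 ^ (-(1 / p) + (ε + b / n)) * G ν := by
          rw [ENNReal.rpow_add _ _ h20 h2t, ENNReal.rpow_add _ _ h20 h2t]; ring
      _ ≤ _ := by
          gcongr
          · norm_num
          · linarith
  have hstep : ∀ ν, ∃ k, boxNorm p F ν ≤ G ν + 2 ^ (-(1 / p)) *
      boxNorm p F (ν + Pi.single k 1) := by
    intro ν
    obtain ⟨k, hk⟩ := exists_le_geom_mean (fun k => boxNorm p (doublingGap k F) ν) hlam0 hlam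
    refine ⟨k, (boxNorm_le_doublingGap_add hp hF k ν).trans (add_le_add (hk.trans ?_) le_rfl)⟩
    refine Finset.prod_le_prod' fun j _ => ENNReal.rpow_le_rpow ?_ (hlam0 j)
    calc boxNorm p (doublingGap j F) ν
        = 2 ^ (β j * ν j) * (2 ^ (-(β j * ν j)) * boxNorm p (doublingGap j F) ν) := by
          rw [← mul_assoc, ← ENNReal.rpow_add _ _ h20 h2t, add_neg_cancel, ENNReal.rpow_zero,
            one_mul]
      _ ≤ _ := by
          gcongr
          exact le_slowMajorant ε (fun ν : Fin n → ℤ =>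
            2 ^ (-(β j * ν j)) * boxNorm p (doublingGap j F) ν) ν
  -- The a priori bound needed to discard the remainder of the iteration: all box norms are at most
  -- ‖F‖_p ≤ ‖f‖_p < ∞.
  have hB : (∫⁻ x, F x ^ p) ^ (1 / p) ≠ ∞ :=
    ENNReal.rpow_ne_top_of_nonneg (by positivity)
      (ne_top_of_le_ne_top hfp (lintegral_iteratedRearrangement_rpow_le hf σ hp))
  have hbox := le_of_exists_step_le hr hρ hB (boxNorm_le_lintegral hp0 F) hstep hGstep ν
  have hGeq : G ν = 2 ^ (b / n * ∑ i, (ν i : ℝ)) * ∏ k, Z k ν ^ (b / (n * β k)) := by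
    simp only [hGdef]
    simp_rw [ENNReal.mul_rpow_of_nonneg _ _ (hlam0 _)]
    rw [Finset.prod_mul_distrib]
    congr 1
    rw [Finset.mul_sum]
    have : ∀ s : Finset (Fin n), ∏ i ∈ s, ((2 : ℝ≥0∞) ^ (β i * ν i)) ^ (b / (n * β i)) =
        2 ^ ∑ i ∈ s, b / n * (ν i : ℝ) := by
      intro s
      induction s using Finset.induction_on with
      | empty => simp
      | insert a s ha ih =>
        rw [Finset.prod_insert ha, Finset.sum_insert ha, ih, ENNReal.rpow_add _ _ h20 h2t,
          ← ENNReal.rpow_mul]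
        congr 2
        have := (hβ a).ne'
        field_simp
    exact this Finset.univ
  have hq1 : 0 ≤ 1 / q := by linarith
  have hq2 : 1 / q ≤ 1 := by
    have h1 : 1 / p ≤ 1 := (div_le_one hp0).2 hp
    have h2 : 0 ≤ b / n := by positivity
    linarith
  have hprod : ENNReal.ofReal ((∏ i, t i) ^ (1 / q)) ≤
      4 ^ n * 2 ^ ((∑ i, (ν i : ℝ)) * (1 / q)) := by
    have ht0 : ∀ i, 0 < t i := fun i =>
      lt_of_lt_of_le (by positivity) (ht i (Set.mem_univ i)).1
    -- The point t lies in the box shifted by one, so t_i < 2^{ν_i + 2}; hence the factor 4 per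
    -- coordinate.
    have h1 : ∏ i, t i ≤ 4 ^ n * 2 ^ (∑ i, (ν i : ℝ)) := by
      calc ∏ i, t i ≤ ∏ i : Fin n, (4 * 2 ^ (ν i : ℝ)) := by
            refine Finset.prod_le_prod (fun i _ => (ht0 i).le) fun i _ => ?_
            refine (ht i (Set.mem_univ i)).2.le.trans_eq ?_
            rw [Real.rpow_intCast, Pi.add_apply, Pi.one_apply, zpow_add_one₀ two_ne_zero,
              zpow_add_one₀ two_ne_zero]
            ring
        _ = _ := by
            rw [Finset.prod_mul_distrib, Real.rpow_sum_of_pos two_pos]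
            simp
    calc _ ≤ ENNReal.ofReal ((4 ^ n * 2 ^ (∑ i, (ν i : ℝ))) ^ (1 / q)) :=
          ENNReal.ofReal_le_ofReal (Real.rpow_le_rpow
            (Finset.prod_nonneg fun i _ => (ht0 i).le) h1 hq1)
      _ ≤ ENNReal.ofReal (4 ^ n * 2 ^ ((∑ i, (ν i : ℝ)) * (1 / q))) := by
          refine ENNReal.ofReal_le_ofReal ?_
          rw [Real.mul_rpow (by positivity) (by positivity), ← Real.rpow_mul two_pos.le]
          gcongr
          calc ((4 : ℝ) ^ n) ^ (1 / q) ≤ (4 ^ n) ^ (1 : ℝ) :=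
                Real.rpow_le_rpow_of_exponent_le (one_le_pow₀ (by norm_num)) hq2
            _ = 4 ^ n := Real.rpow_one _
      _ = _ := by
          rw [ENNReal.ofReal_mul (by positivity), ENNReal.ofReal_pow (by norm_num),
            ← ENNReal.ofReal_rpow_of_pos two_pos]
          simp
  calc _ ≤ 4 ^ n * 2 ^ ((∑ i, (ν i : ℝ)) * (1 / q)) * F t := by gcongr
    _ = 4 ^ n * 2 ^ (-(b / n * ∑ i, (ν i : ℝ))) * (2 ^ ((∑ i, (ν i : ℝ)) / p) * F t) := by
        have : (∑ i, (ν i : ℝ)) * (1 / q) =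
            -(b / n * ∑ i, (ν i : ℝ)) + (∑ i, (ν i : ℝ)) / p := by
          rw [hq]; ring
        rw [this, ENNReal.rpow_add _ _ h20 h2t]
        ring
    _ ≤ 4 ^ n * 2 ^ (-(b / n * ∑ i, (ν i : ℝ))) * ((1 - 2 ^ (-ε))⁻¹ * G ν) := by
        exact mul_le_mul' le_rfl ((iteratedRearrangement_mul_le_boxNorm σ f hp0 ht).trans hbox)
    _ = 4 ^ n * (1 - 2 ^ (-ε))⁻¹ * (2 ^ (-(b / n * ∑ i, (ν i : ℝ)) + b / n * ∑ i, (ν i : ℝ)) *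
        ∏ k, Z k ν ^ (b / (n * β k))) := by
        rw [hGeq, ENNReal.rpow_add _ _ h20 h2t]; ring
    _ = _ := by rw [neg_add_cancel, ENNReal.rpow_zero, one_mul]

/-- A function bounded by `P ν` on the `ν`-th dyadic box has its integral against `dt / π(t)` over
the positive orthant bounded by the sum of the `P ν`. -/
lemma lintegral_posOrthant_div_prod_le {H : (Fin n → ℝ) → ℝ≥0∞} {P : (Fin n → ℤ) → ℝ≥0∞}
    (h : ∀ ν, ∀ t ∈ dyadicBox (ν + 1), H t ≤ P ν) :
    ∫⁻ t in posOrthant n, H t / ENNReal.ofReal (∏ i, t i) ≤ ∑' ν, P ν := by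
  calc _ ≤ ∫⁻ t in ⋃ ν : Fin n → ℤ, dyadicBox ν, H t / ENNReal.ofReal (∏ i, t i) :=
        lintegral_mono_set posOrthant_subset_iUnion_dyadicBox
    _ ≤ ∑' ν : Fin n → ℤ, ∫⁻ t in dyadicBox ν, H t / ENNReal.ofReal (∏ i, t i) :=
        lintegral_iUnion_le _ _
    _ = ∑' ν : Fin n → ℤ, ∫⁻ t in dyadicBox (ν + 1), H t / ENNReal.ofReal (∏ i, t i) :=
        ((Equiv.addRight (1 : Fin n → ℤ)).tsum_eq fun ν =>
          ∫⁻ t in dyadicBox ν, H t / ENNReal.ofReal (∏ i, t i)).symm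
    _ ≤ _ := by
        refine ENNReal.tsum_le_tsum fun ν => ?_
        -- V is both the volume of the box and the minimum of π over it, so the box has
        -- dt/π(t)-measure at most 1.
        set V : ℝ := ∏ i, (2 : ℝ) ^ (ν + 1 : Fin n → ℤ) i with hV
        have hV0 : 0 < V := Finset.prod_pos fun i _ => by positivity
        calc _ ≤ ∫⁻ _ in dyadicBox (ν + 1), P ν / ENNReal.ofReal V := by
              refine setLIntegral_mono' (measurableSet_dyadicBox _) fun t ht => ?_
              refine ENNReal.div_le_div (h ν t ht) (ENNReal.ofReal_le_ofReal ?_)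
              exact Finset.prod_le_prod (fun i _ => by positivity) fun i _ =>
                (ht i (Set.mem_univ i)).1
          _ = P ν := by
              rw [setLIntegral_const, volume_dyadicBox, ← hV]
              exact ENNReal.div_mul_cancel (ENNReal.ofReal_pos.2 hV0).ne' ENNReal.ofReal_ne_top

lemma modLorentzNorm_le_of_measurable {f : (Fin n → ℝ) → ℝ} (hf : Measurable f)
    (hn : 0 < n) (σ : Equiv.Perm (Fin n)) {p q b ε : ℝ} {β : Fin n → ℝ} {θ : Fin n → ℝ≥0∞}
    {θm K : ℝ≥0∞} (hp : 1 ≤ p) (hfp : ∫⁻ x, ‖f x‖ₑ ^ p ≠ ∞)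
    (hθ : ∀ j, ENNReal.ofReal p ≤ θ j) (hβ : ∀ j, 0 < β j ∧ β j < 1) (hb : 0 < b)
    (hlam : ∑ j, b / (n * β j) = 1) (hq : 1 / q = 1 / p - b / n) (hε : 0 < ε)
    (hqε : 2 * ε ≤ 1 / q)
    (hθm : θm = ENNReal.ofReal (n / b) * (∑ j, 1 / (ENNReal.ofReal (β j) * θ j))⁻¹)
    (hK : ∑' ξ : Fin n → ℤ, latticeWeight ε ξ ≤ K) (hK1 : 1 ≤ K) :
    modLorentzNorm q θm σ f ≤ 4 ^ n * (1 - 2 ^ (-ε))⁻¹ * (K * 192) *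
      ∏ j, (ENNReal.ofReal ((1 - β j) ^ (1 / θ j).toReal) *
        besovSeminorm (β j) p (θ j) j f) ^ (b / (n * β j)) := by
  have hβ0 : ∀ j, 0 < β j := fun j => (hβ j).1
  have hlam0 : ∀ k, 0 ≤ b / (n * β k) := fun k => by have := hβ0 k; positivity
  have h1θ : ∀ j, 1 ≤ θ j := fun j => le_trans (by
    rw [← ENNReal.ofReal_one]; exact ENNReal.ofReal_le_ofReal hp) (hθ j)
  have hθ0 : ∀ j, θ j ≠ 0 := fun j => (zero_lt_one.trans_le (h1θ j)).ne'
  set X : Fin n → ℝ≥0∞ := fun j => ENNReal.ofReal ((1 - β j) ^ (1 / θ j).toReal) *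
    besovSeminorm (β j) p (θ j) j f with hX
  set Z : Fin n → (Fin n → ℤ) → ℝ≥0∞ := fun k => slowMajorant ε (fun ν : Fin n → ℤ =>
    2 ^ (-(β k * ν k)) * boxNorm p (doublingGap k (iteratedRearrangement σ f)) ν) with hZ
  have hZX : ∀ k, LpSumLe (θ k) (Z k) (K * (192 * X k)) := fun k =>
    (lpSumLe_boxNorm_doublingGap hf σ k hp (hθ k) (hβ k).2).slowMajorant hε.le (h1θ k) hK hK1
  set A : ℝ≥0∞ := 4 ^ n * (1 - 2 ^ (-ε))⁻¹ with hA
  have hpt : ∀ ν, ∀ t ∈ dyadicBox (ν + 1), ENNReal.ofReal ((∏ i, t i) ^ (1 / q)) *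
      iteratedRearrangement σ f t ≤ A * ∏ k, Z k ν ^ (b / (n * β k)) := fun ν t ht =>
    iteratedRearrangement_le_prod_slowMajorant hf hn σ hp hfp hβ0 hb hlam hq hε hqε ht
  -- Since ∑ λ_k = 1, constants common to all factors come out of the geometric mean to the first
  -- power.
  have hprod : ∏ k, (K * (192 * X k)) ^ (b / (n * β k)) =
      K * 192 * ∏ k, X k ^ (b / (n * β k)) := by
    simp_rw [← mul_assoc, ENNReal.mul_rpow_of_nonneg _ _ (hlam0 _)]
    rw [Finset.prod_mul_distrib, Finset.prod_mul_distrib,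
      rpow_sum_of_nonneg _ _ fun j _ => hlam0 j, rpow_sum_of_nonneg _ _ fun j _ => hlam0 j, hlam,
      ENNReal.rpow_one, ENNReal.rpow_one]
  rw [mul_assoc, ← hprod]
  have hinv := inv_meanExponent_eq hβ0 hb hθm hn
  unfold modLorentzNorm
  split_ifs with hinf
  · have hθinf : ∀ j, θ j = ∞ := by
      intro j
      rw [hinf, ENNReal.inv_top, eq_comm, Finset.sum_eq_zero_iff] at hinv
      rcases mul_eq_zero.1 (hinv j (Finset.mem_univ j)) with h | h
      · have : 0 < b / (n * β j) := by
          have := hβ0 j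
          have : (0 : ℝ) < n := by exact_mod_cast hn
          positivity
        exact absurd h (ENNReal.ofReal_pos.2 this).ne'
      · exact ENNReal.inv_eq_zero.1 h
    refine essSup_le_of_ae_le _ ?_
    refine (ae_restrict_iff' ?_).2 (Filter.Eventually.of_forall fun t ht => ?_)
    · have : posOrthant n = Set.univ.pi fun _ => Set.Ioi 0 := by
        ext t; simp [posOrthant]
      rw [this]
      exact MeasurableSet.univ_pi fun _ => measurableSet_Ioi
    · obtain ⟨ν, hν⟩ := Set.mem_iUnion.1 (posOrthant_subset_iUnion_dyadicBox ht)
      rw [← sub_add_cancel ν 1] at hν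
      refine (hpt _ t hν).trans (mul_le_mul' le_rfl (Finset.prod_le_prod' fun k _ => ?_))
      have := hZX k
      rw [LpSumLe, if_pos (hθinf k)] at this
      exact ENNReal.rpow_le_rpow (this _) (hlam0 k)
  · have hterm : ∀ j, ENNReal.ofReal (b / (n * β j)) * (θ j)⁻¹ ≠ ∞ := fun j =>
      ENNReal.mul_ne_top ENNReal.ofReal_ne_top (ENNReal.inv_ne_top.2 (hθ0 j))
    have hθm0 : θm ≠ 0 := by
      rw [← ENNReal.inv_ne_top, hinv]
      exact (ENNReal.sum_lt_top.2 fun j _ => (hterm j).lt_top).ne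
    have ht0 : 0 < θm.toReal := ENNReal.toReal_pos hθm0 hinf
    have hsum : ∑ k, b / (n * β k) * (θ k).toReal⁻¹ = θm.toReal⁻¹ := by
      rw [← ENNReal.toReal_inv, hinv, ENNReal.toReal_sum fun j _ => hterm j]
      refine Finset.sum_congr rfl fun j _ => ?_
      rw [ENNReal.toReal_mul, ENNReal.toReal_ofReal (hlam0 j), ENNReal.toReal_inv]
    rw [one_div θm.toReal, ENNReal.rpow_inv_le_iff ht0]
    refine (lintegral_posOrthant_div_prod_le (P := fun ν =>
      (A * ∏ k, Z k ν ^ (b / (n * β k))) ^ θm.toReal) fun ν t ht =>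
        ENNReal.rpow_le_rpow (hpt ν t ht) ht0.le).trans ?_
    simp_rw [ENNReal.mul_rpow_of_nonneg _ _ ht0.le]
    rw [ENNReal.tsum_mul_left]
    exact mul_le_mul' le_rfl (tsum_prod_rpow_le hθ0 hZX hlam0 ht0 hsum)

end Embedding

theorem theorem5p1 (n : ℕ) (hn : 2 ≤ n) (Q : ℝ) :
    ∃ c : ℝ, 0 < c ∧
      ∀ (p : ℝ) (θ : Fin n → ℝ≥0∞) (β : Fin n → ℝ) (βm : ℝ) (θm : ℝ≥0∞) (q : ℝ),
        1 ≤ p →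
        (∀ j, ENNReal.ofReal p ≤ θ j) →
        (∀ j, 0 < β j ∧ β j < 1) →
        βm = n * (∑ j, 1 / β j)⁻¹ →
        θm = ENNReal.ofReal (n / βm) * (∑ j, 1 / (ENNReal.ofReal (β j) * θ j))⁻¹ →
        p < n / βm →
        q = n * p / (n - βm * p) →
        q ≤ Q →
        ∀ f : (Fin n → ℝ) → ℝ,
          (∀ j, MemBesov (β j) p (θ j) j f) →
          ∀ σ : Equiv.Perm (Fin n),
            modLorentzNorm q θm σ f ≤
              ENNReal.ofReal c *
                ∏ j, (ENNReal.ofReal ((1 - β j) ^ (1 / θ j).toReal) *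
                  besovSeminorm (β j) p (θ j) j f) ^ (βm / (n * β j)) := by
  have hn0 : 0 < n := by omega
  have hn' : (0 : ℝ) < n := by exact_mod_cast hn0
  have : Nonempty (Fin n) := ⟨⟨0, hn0⟩⟩
  -- The choice ε = 1/(2Q') makes 2ε = 1/Q' ≤ 1/q for all admissible q; the maximum with 1 only
  -- ensures Q' > 0. Every constant below depends on n and ε alone.
  set Q' : ℝ := max Q 1 with hQ'
  have hQ'0 : 0 < Q' := lt_of_lt_of_le one_pos (le_max_right _ _)
  set ε : ℝ := 1 / (2 * Q') with hεdef
  have hε : 0 < ε := by positivity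
  set K : ℝ≥0∞ := max (∑' ξ : Fin n → ℤ, latticeWeight ε ξ) 1 with hK
  have hKt : K ≠ ∞ := max_ne_top (tsum_latticeWeight_ne_top hε) ENNReal.one_ne_top
  have hρ : (2 : ℝ≥0∞) ^ (-ε) < 1 :=
    ENNReal.rpow_lt_one_of_one_lt_of_neg (by norm_num) (by linarith)
  set C : ℝ≥0∞ := 4 ^ n * (1 - 2 ^ (-ε))⁻¹ * (K * 192) with hC
  have hCt : C ≠ ∞ := by
    refine ENNReal.mul_ne_top (ENNReal.mul_ne_top (ENNReal.pow_ne_top (by norm_num))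
      (ENNReal.inv_ne_top.2 (tsub_pos_of_lt hρ).ne')) (ENNReal.mul_ne_top hKt (by norm_num))
  refine ⟨C.toReal + 1, by positivity, ?_⟩
  intro p θ β βm θm q hp hθ hβ hβm hθm hpβ hq hqQ f hf σ
  have hp0 : 0 < p := by linarith
  have hS : 0 < ∑ j, 1 / β j :=
    Finset.sum_pos (fun j _ => one_div_pos.2 (hβ j).1) Finset.univ_nonempty
  have hb : 0 < βm := by rw [hβm]; positivity
  have hlam : ∑ j, βm / (n * β j) = 1 := by
    have : ∀ j, βm / (n * β j) = (βm / n) * (1 / β j) := fun j => by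
      have := (hβ j).1
      field_simp
    simp_rw [this]
    rw [← Finset.mul_sum, hβm]
    field_simp
  have hden : 0 < n - βm * p := by
    rw [lt_div_iff₀ hb] at hpβ
    linarith
  have hq0 : 0 < q := by rw [hq]; positivity
  have hqinv : 1 / q = 1 / p - βm / n := by
    rw [hq]
    field_simp
  have hqε : 2 * ε ≤ 1 / q := by
    have h1 : 2 * ε = 1 / Q' := by rw [hεdef]; field_simp
    rw [h1]
    exact one_div_le_one_div_of_le hq0 (hqQ.trans (le_max_left _ _))
  have hmem : MemLp f (ENNReal.ofReal p) volume := (hf ⟨0, hn0⟩).1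
  -- The function f is only almost everywhere measurable; both sides depend only on its class, so a
  -- Borel representative may be used.
  obtain ⟨g, hg, hfg⟩ := hmem.1.aemeasurable
  have hgp : ∫⁻ x, ‖g x‖ₑ ^ p ≠ ∞ := by
    have h1 := (lintegral_rpow_enorm_lt_top_of_eLpNorm_lt_top (ENNReal.ofReal_pos.2 hp0).ne'
      ENNReal.ofReal_ne_top hmem.2).ne
    rw [ENNReal.toReal_ofReal hp0.le] at h1
    have h2 : ∫⁻ x, ‖f x‖ₑ ^ p = ∫⁻ x, ‖g x‖ₑ ^ p :=
      lintegral_congr_ae (hfg.fun_comp fun y => ‖y‖ₑ ^ p)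
    rwa [← h2]
  rw [modLorentzNorm_congr_ae hfg]
  simp_rw [besovSeminorm_congr_ae hfg]
  refine (modLorentzNorm_le_of_measurable hg hn0 σ hp hgp hθ hβ hb hlam hqinv hε hqε hθm
    (le_max_left _ _) (le_max_right _ _)).trans (mul_le_mul' ?_ le_rfl)
  change C ≤ _
  rw [← ENNReal.ofReal_toReal hCt]
  exact ENNReal.ofReal_le_ofReal (by rw [ENNReal.toReal_ofReal ENNReal.toReal_nonneg]; linarith)
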